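/- Let $n\ge 1$, $m\ge 2$, $i\in\{1,\dots,m\}$. For $\vec p=(p_1,\dots,p_n)\in(0,\infty)^n$ and a measurable $f:\mathbb R^n\to\mathbb C$ let $$\|f\|_{L^{\vec p}}=\Big(\int_{\mathbb R}\cdots\Big(\int_{\mathbb R}\Big(\int_{\mathbb R}|f(x_1,\dots,x_n)|^{p_1}dx_1\Big)^{p_2/p_1}dx_2\Big)^{p_3/p_2}\cdots dx_n\Big)^{1/p_n},$$ and let $L^{\vec p}$ be the space of measurable $f$ with $\|f\|_{L^{\vec p}}<\infty$. For a measurable $\varphi:\mathbb R^n\times(0,\infty)\to(0,\infty)$ let $M^{\varphi}_{\vec p}$ be the space of measurable $f$ with $$\|f\|_{M^{\varphi}_{\vec p}}=\sup_{x\in\mathbb R^n,\,r>0}\varphi(x,r)^{-1}\,\|\chi_{B(x,r)}\|_{L^{\vec p}}^{-1}\,\|f\chi_{B(x,r)}\|_{L^{\vec p}}<\infty .$$ Let $1<\vec q_k<\infty$ (componentwise) for $k=1,\dots,m$, let $1/\vec q=1/\vec q_1+\cdots+1/\vec q_m$ componentwise, and let $\varphi,\varphi_1,\dots,\varphi_m:\mathbb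 R^n\times(0,\infty)\to(0,\infty)$ be Lebesgue measurable, with each $\varphi_k(x,\cdot)$ measurable for every $x$, such that for some constant $C$ and all $x\in\mathbb R^n$, $r>0$, $$\int_r^\infty\Big(1+\ln\frac tr\Big)\frac{\varphi_i(x,t)}t\,dt\cdot\prod_{k\ne i}\int_r^\infty\frac{\varphi_k(x,t)}t\,dt\le C\,\varphi(x,r).$$ Let $b\in\mathrm{BMO}(\mathbb R^n)$, that is, $b$ is locally integrable and its mean oscillations $\frac1{|B|}\int_B|b-b_B|$ are bounded uniformly over all balls $B$. For each $k$ let $V_k$ be a complex vector space of measurable functions on $\mathbb R^n$ that contains $L^{\vec q_k}$ and $M^{\varphi_k}_{\vec q_k}$. Let $T=T^b_{m,i}$ be an operator that takes each $\vec f=(f_1,\dots,f_m)\in V_1\times\cdots\times V_m$ to a measurable function $T(\vec f):\mathbb R^n\to\mathbb C$ and that has the following properties. 1. $T$ is multi-sublinear: in each variable, the others being fixed, $|T(\dots,g+h,\dots)|\le|T(\dots,g,\dots)|+|T(\dots,h,\dots)|$ and $|T(\dots,cg,\dots)|=|c|\,|T(\dots,g,\dots)|$ for $c\in\mathbb C$,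 almost everywhere. 2. There is a constant $C$ such that for every $\vec f\in V_1\times\cdots\times V_m$ and almost every $x\notin\bigcap_{j=1}^m\operatorname{supp}f_j$, $$|T(\vec f)(x)|\le C\int_{(\mathbb R^n)^m}\frac{|b(x)-b(y_i)|}{|(x-y_1,\dots,x-y_m)|^{mn}}\,|f_1(y_1)\cdots f_m(y_m)|\,dy_1\cdots dy_m$$ (the right-hand side may be $\infty$). 3. $T$ is bounded from $L^{\vec q_1}\times\cdots\times L^{\vec q_m}$ to $L^{\vec q}$: there is a constant $C$ with $\|T(\vec f)\|_{L^{\vec q}}\le C\prod_{k=1}^m\|f_k\|_{L^{\vec q_k}}$ for all $f_k\in L^{\vec q_k}$. Then $T$ is bounded from $M^{\varphi_1}_{\vec q_1}\times\cdots\times M^{\varphi_m}_{\vec q_m}$ to $M^{\varphi}_{\vec q}$: there is a constant $C$ such that $T(\vec f)\in M^{\varphi}_{\vec q}$ and $$\|T(\vec f)\|_{M^{\varphi}_{\vec q}}\le C\prod_{k=1}^m\|f_k\|_{M^{\varphi_k}_{\vec q_k}}\qquad\text{for all } f_k\in M^{\varphi_k}_{\vec q_k},\ k=1,\dots,m.$$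 -/

import Mathlib

open MeasureTheory
open scoped ENNReal NNReal

noncomputable section

namespace MixedMorrey

/-- `ℝⁿ` with its Euclidean norm and Lebesgue measure. -/
abbrev Rn (n : ℕ) : Type := EuclideanSpace ℝ (Fin n)

/-- The iterated norm
`(∫ ⋯ (∫ (∫ g(x₁,…,xₙ)^{p₁} dx₁)^{p₂/p₁} dx₂)^{p₃/p₂} ⋯ dxₙ)^{1/pₙ}`
of a function with values in `[0,∞]`, for exponents in `(0,∞)`: the innermost integration is
over the first coordinate, and the result is treated in the same way as a function of the
remaining coordinates. -/
def iterNorm : (n : ℕ) → (Fin n → ℝ) → ((Fin n → ℝ) → ℝ≥0∞) → ℝ≥0∞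
  | 0, _, g => g Fin.elim0
  | n + 1, p, g =>
      iterNorm n (Fin.tail p)
        (fun y => (∫⁻ t : ℝ, g (Fin.cons t y) ^ p 0) ^ (1 / p 0))

/-- The mixed Lebesgue (quasi-)norm of `f : ℝⁿ → ℂ`, for `p` in `(0,∞)ⁿ`. -/
def mixedNorm {n : ℕ} (p : Fin n → ℝ) (f : Rn n → ℂ) : ℝ≥0∞ :=
  iterNorm n p (fun v => ‖f (WithLp.toLp 2 v)‖ₑ)

/-- Membership in the mixed Lebesgue space. `AEMeasurable` with respect to Lebesgue measure is
Lebesgue measurability. -/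
def MemMixedLp {n : ℕ} (p : Fin n → ℝ) (f : Rn n → ℂ) : Prop :=
  AEMeasurable f volume ∧ mixedNorm p f < ∞

/-- The characteristic function of the open ball `B(x,r)`. -/
def chiBall {n : ℕ} (x : Rn n) (r : ℝ) : Rn n → ℂ :=
  (Metric.ball x r).indicator (fun _ => 1)

/-- The generalized mixed Morrey (quasi-)norm
`sup_{x, r > 0} φ(x,r)⁻¹ ‖χ_{B(x,r)}‖⁻¹ ‖f χ_{B(x,r)}‖`. -/
def morreyNorm {n : ℕ} (φ : Rn n → ℝ → ℝ) (q : Fin n → ℝ) (f : Rn n → ℂ) : ℝ≥0∞ :=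
  ⨆ (x : Rn n) (r : ℝ) (_ : 0 < r),
    (ENNReal.ofReal (φ x r))⁻¹ * (mixedNorm q (chiBall x r))⁻¹ *
      mixedNorm q ((Metric.ball x r).indicator f)

/-- Membership in the generalized mixed Morrey space. -/
def MemMorrey {n : ℕ} (φ : Rn n → ℝ → ℝ) (q : Fin n → ℝ) (f : Rn n → ℂ) : Prop :=
  AEMeasurable f volume ∧ morreyNorm φ q f < ∞

/-- `φ` is a Lebesgue measurable function `ℝⁿ × (0,∞) → (0,∞)` (its values at `r ≤ 0` are
never used). -/
def IsWeightFun {n : ℕ} (φ : Rn n → ℝ → ℝ) : Prop :=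
  (∀ x, ∀ r, 0 < r → 0 < φ x r) ∧
    AEMeasurable (Function.uncurry φ)
      ((volume : Measure (Rn n × ℝ)).restrict (Set.univ ×ˢ Set.Ioi 0))

/-- The space of functions of bounded mean oscillation. -/
def MemBMO {n : ℕ} (b : Rn n → ℂ) : Prop :=
  LocallyIntegrable b volume ∧
    (⨆ (x : Rn n) (r : ℝ) (_ : 0 < r),
      (volume (Metric.ball x r))⁻¹ *
        ∫⁻ y in Metric.ball x r, ‖b y - ⨍ z in Metric.ball x r, b z‖ₑ) < ∞

/-- `T` is sublinear in each variable on `V₁ × ⋯ × Vₘ`. -/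
structure IsMultiSublinearOn {n m : ℕ} (V : Fin m → Submodule ℂ (Rn n → ℂ))
    (T : (Fin m → Rn n → ℂ) → Rn n → ℂ) : Prop where
  add_le : ∀ f : Fin m → Rn n → ℂ, (∀ j, f j ∈ V j) →
    ∀ k, ∀ g ∈ V k, ∀ h ∈ V k, ∀ᵐ x,
      ‖T (Function.update f k (g + h)) x‖ ≤
        ‖T (Function.update f k g) x‖ + ‖T (Function.update f k h) x‖
  smul_eq : ∀ f : Fin m → Rn n → ℂ, (∀ j, f j ∈ V j) →
    ∀ k, ∀ g ∈ V k, ∀ c : ℂ, ∀ᵐ x,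
      ‖T (Function.update f k (c • g)) x‖ = ‖c‖ * ‖T (Function.update f k g) x‖

/-- The integral over `(ℝⁿ)ᵐ` of
`|b(x) - b(yᵢ)| |(x - y₁, …, x - yₘ)|^{-mn} |f₁(y₁) ⋯ fₘ(yₘ)|`,
with the Euclidean norm on `(ℝⁿ)ᵐ`. -/
def sizeIntegral {n m : ℕ} (b : Rn n → ℂ) (i : Fin m) (f : Fin m → Rn n → ℂ) (x : Rn n) :
    ℝ≥0∞ :=
  ∫⁻ y : Fin m → Rn n,
    ‖b x - b (y i)‖ₑ / ENNReal.ofReal (Real.sqrt (∑ k, ‖x - y k‖ ^ 2)) ^ (m * n) *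
      ∏ k, ‖f k (y k)‖ₑ

/-- The size condition for commutators: for `f` in `V₁ × ⋯ × Vₘ`, almost everywhere off
`⋂ⱼ supp fⱼ`, `|T f|` is at most a constant times `sizeIntegral b i f`. -/
def CommutatorSize {n m : ℕ} (V : Fin m → Submodule ℂ (Rn n → ℂ)) (b : Rn n → ℂ) (i : Fin m)
    (T : (Fin m → Rn n → ℂ) → Rn n → ℂ) : Prop :=
  ∃ C : ℝ≥0, ∀ f : Fin m → Rn n → ℂ, (∀ k, f k ∈ V k) →
    ∀ᵐ x, x ∉ ⋂ j, tsupport (f j) → ‖T f x‖ₑ ≤ C * sizeIntegral b i f x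

end MixedMorrey

end

noncomputable section

namespace MixedMorrey

/-! ### The iterated norm -/

/-! Fix a ball `B = B(x,r)` and split each `f_k` into its restriction to `2B` and the rest.
Replacing the `f_k` by their local parts one at a time, sublinearity bounds `|T f|` on `B` by `|T
f₀|`, with every entry local, plus `m` terms `|T g|` in which some entry of `g` is a far part.

The local term is controlled by the boundedness of `T` on mixed Lebesgue spaces. The norm of `f_k`
on `2B` is at most its norm on `B(x,t)` for every `t > 2r`; averaging over `t` with weight
`t^{-s-1}` produces `∫_r^∞ φ_k(x,t) dt/t` without any monotonicity of `φ_k`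
(`mixedNorm_double_ball_le`).

For a far term the size condition applies on `B`. One `y_k` lies outside `2B`, so the kernel is at
most a constant times `∏ max(r,|y_k - x|)^{-n}` (`inv_pow_norm_le`). With `|b(z) - b(y_i)| ≤ |b(z) -
b_B| + |b(y_i) - b_B|` the multiple integral splits into one-variable potentials
(`sizeIntegral_le`). Each potential is a superposition of integrals over balls `B(x,t)`, `t > r`, to
which Hölder's inequality applies (`potential_le`). The logarithm comes from the factor `b - b_B`,
whose dual mixed norm over `B(x,t)` is `O((1 + ln(t/r)) t^σ)`, where `t^σ` is the size of the norm
of the characteristic function.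

The bounds on `b` rest on the John–Nirenberg inequality `exists_volume_oscillation_le`, proved with
stopping balls and Vitali covering. It controls every `L^P` oscillation, and Hölder's inequality
passes from a large constant exponent `P` to any mixed exponent. Since the components of `q` may be
below 1, only a quasi-triangle inequality is available for the target norm. -/

lemma measurePreserving_cons (n : ℕ) :
    MeasurePreserving (fun z : (Fin n → ℝ) × ℝ => (Fin.cons z.2 z.1 : Fin (n + 1) → ℝ))
      (volume.prod volume) volume := by
  have h := (volume_preserving_piFinSuccAbove (fun _ : Fin (n + 1) => ℝ) 0).symm
  have h2 := h.comp (Measure.measurePreserving_swap (μ := (volume : Measure (Fin n → ℝ)))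
    (ν := (volume : Measure ℝ)))
  have h3 : (fun z : (Fin n → ℝ) × ℝ => (Fin.cons z.2 z.1 : Fin (n + 1) → ℝ)) =
      (MeasurableEquiv.piFinSuccAbove (fun _ : Fin (n + 1) => ℝ) 0).symm ∘ Prod.swap := by
    funext z
    simp [MeasurableEquiv.piFinSuccAbove, Fin.insertNthEquiv]
  rw [h3]
  exact h2

lemma ae_cons {n : ℕ} {P : (Fin (n + 1) → ℝ) → Prop} (h : ∀ᵐ v, P v) :
    ∀ᵐ y : Fin n → ℝ, ∀ᵐ t : ℝ, P (Fin.cons t y) :=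
  Measure.ae_ae_of_ae_prod ((measurePreserving_cons n).quasiMeasurePreserving.ae h)

lemma lintegral_cons {n : ℕ} {g : (Fin (n + 1) → ℝ) → ℝ≥0∞} (hg : Measurable g) :
    ∫⁻ v, g v = ∫⁻ y : Fin n → ℝ, ∫⁻ t : ℝ, g (Fin.cons t y) := by
  rw [← (measurePreserving_cons n).lintegral_comp hg, lintegral_prod]
  exact (hg.comp (measurePreserving_cons n).measurable).aemeasurable

lemma measurable_inner_norm {n : ℕ} {g : (Fin (n + 1) → ℝ) → ℝ≥0∞} (hg : Measurable g) (p : ℝ) :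
    Measurable (fun y : Fin n → ℝ => (∫⁻ t : ℝ, g (Fin.cons t y) ^ p) ^ (1 / p)) := by
  have := ((hg.comp (measurePreserving_cons n).measurable).pow_const p).lintegral_prod_right'
    (ν := (volume : Measure ℝ))
  exact this.pow_const _

lemma measurable_comp_cons {n : ℕ} {g : (Fin (n + 1) → ℝ) → ℝ≥0∞} (hg : Measurable g)
    (y : Fin n → ℝ) : Measurable (fun t : ℝ => g (Fin.cons t y)) :=
  (hg.comp (measurePreserving_cons n).measurable).comp measurable_prodMk_left

lemma iterNorm_mono_ae {n : ℕ} {p : Fin n → ℝ} (hp : ∀ j, 0 < p j)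
    {g h : (Fin n → ℝ) → ℝ≥0∞} (hgh : ∀ᵐ v, g v ≤ h v) : iterNorm n p g ≤ iterNorm n p h := by
  induction n with
  | zero =>
    -- The one-point space has nonzero measure, so an almost everywhere inequality holds at the
    -- point.
    rw [ae_iff] at hgh
    by_contra hcon
    have : {a : Fin 0 → ℝ | ¬ g a ≤ h a} = Set.univ := by
      ext a
      simpa [Subsingleton.elim a Fin.elim0, iterNorm] using hcon
    rw [this] at hgh
    simp [volume_pi] at hgh
  | succ n ih =>
    refine ih (fun j => hp j.succ) ?_
    filter_upwards [ae_cons hgh] with y hy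
    refine ENNReal.rpow_le_rpow (lintegral_mono_ae ?_) (by have := hp 0; positivity)
    filter_upwards [hy] with t ht
    exact ENNReal.rpow_le_rpow ht (hp 0).le

lemma iterNorm_const_mul {n : ℕ} {p : Fin n → ℝ} (hp : ∀ j, 0 < p j) (c : ℝ≥0∞)
    {g : (Fin n → ℝ) → ℝ≥0∞} (hg : Measurable g) :
    iterNorm n p (fun v => c * g v) = c * iterNorm n p g := by
  induction n with
  | zero => rfl
  | succ n ih =>
    have h0 := hp 0
    rw [iterNorm, iterNorm,
      ← ih (p := Fin.tail p) (fun j => hp j.succ) (measurable_inner_norm hg _)]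
    congr 1
    funext y
    simp_rw [ENNReal.mul_rpow_of_nonneg _ _ h0.le]
    rw [lintegral_const_mul _ ((measurable_comp_cons hg y).pow_const _),
      ENNReal.mul_rpow_of_nonneg _ _ (by positivity), ← ENNReal.rpow_mul,
      mul_one_div_cancel h0.ne', ENNReal.rpow_one]

lemma add_rpow_le_two_rpow_mul (a b : ℝ≥0∞) {s : ℝ} (hs : 0 ≤ s) :
    (a + b) ^ s ≤ 2 ^ s * (a ^ s + b ^ s) := by
  rcases le_total a b with h | h
  · calc (a + b) ^ s ≤ (2 * b) ^ s := by rw [two_mul]; gcongr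
      _ = 2 ^ s * b ^ s := ENNReal.mul_rpow_of_nonneg _ _ hs
      _ ≤ _ := by gcongr; exact le_add_self
  · calc (a + b) ^ s ≤ (2 * a) ^ s := by rw [two_mul]; gcongr
      _ = 2 ^ s * a ^ s := ENNReal.mul_rpow_of_nonneg _ _ hs
      _ ≤ _ := by gcongr; exact le_self_add

/-- Exponents below 1 are allowed, so Minkowski's inequality is replaced by `(a + b)^s ≤ 2^s (a^s +
b^s)`, used twice per coordinate: with `s = p 0` inside the integral and `s = 1 / p 0` outside. -/
lemma exists_iterNorm_add_le {n : ℕ} {p : Fin n → ℝ} (hp : ∀ j, 0 < p j) :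
    ∃ K : ℝ≥0, ∀ g h : (Fin n → ℝ) → ℝ≥0∞, Measurable g → Measurable h →
      iterNorm n p (fun v => g v + h v) ≤ K * (iterNorm n p g + iterNorm n p h) := by
  induction n with
  | zero => exact ⟨1, fun g h _ _ => by simp [iterNorm]⟩
  | succ n ih =>
    obtain ⟨K, hK⟩ := ih (p := Fin.tail p) (fun j => hp j.succ)
    have h0 := hp 0
    have h1 : 0 ≤ 1 / p 0 := by positivity
    refine ⟨2 * 2 ^ (1 / p 0) * K, fun g h hg hh => ?_⟩
    have hc : ((2 * 2 ^ (1 / p 0) * K : ℝ≥0) : ℝ≥0∞) = 2 * 2 ^ (1 / p 0) * K := by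
      push_cast
      rw [ENNReal.coe_rpow_of_nonneg _ h1]
      norm_num
    rw [hc, mul_assoc]
    refine le_trans ?_ (mul_le_mul_right (hK _ _ (measurable_inner_norm hg (p 0))
      (measurable_inner_norm hh (p 0))) _)
    refine le_trans ?_ (iterNorm_const_mul (p := Fin.tail p) (fun j => hp j.succ) _
      ((measurable_inner_norm hg (p 0)).add (measurable_inner_norm hh (p 0)))).le
    refine iterNorm_mono_ae (fun j => hp j.succ) (Filter.Eventually.of_forall fun y => ?_)
    calc (∫⁻ t : ℝ, (g (Fin.cons t y) + h (Fin.cons t y)) ^ p 0) ^ (1 / p 0)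
        ≤ (∫⁻ t : ℝ, 2 ^ p 0 * (g (Fin.cons t y) ^ p 0 + h (Fin.cons t y) ^ p 0)) ^ (1 / p 0) := by
          refine ENNReal.rpow_le_rpow (lintegral_mono fun t => ?_) h1
          exact add_rpow_le_two_rpow_mul _ _ h0.le
      _ = 2 * (∫⁻ t : ℝ, g (Fin.cons t y) ^ p 0 + h (Fin.cons t y) ^ p 0) ^ (1 / p 0) := by
          rw [lintegral_const_mul' _ _ (ENNReal.rpow_ne_top_of_nonneg h0.le (by simp)),
            ENNReal.mul_rpow_of_nonneg _ _ h1,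
            ← ENNReal.rpow_mul, mul_one_div_cancel h0.ne', ENNReal.rpow_one]
      _ = 2 * ((∫⁻ t : ℝ, g (Fin.cons t y) ^ p 0) + ∫⁻ t : ℝ, h (Fin.cons t y) ^ p 0) ^
            (1 / p 0) := by
          rw [lintegral_add_left ((measurable_comp_cons hg y).pow_const _)]
      _ ≤ _ := by
          rw [mul_assoc]
          gcongr
          exact add_rpow_le_two_rpow_mul _ _ h1

/-- Hölder's inequality in the innermost variable, then induction on the remaining ones. -/
lemma iterNorm_mul_le {n : ℕ} {p a b : Fin n → ℝ} (hp : ∀ j, 0 < p j) (ha : ∀ j, 0 < a j)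
    (hb : ∀ j, 0 < b j) (hab : ∀ j, 1 / p j = 1 / a j + 1 / b j)
    {g h : (Fin n → ℝ) → ℝ≥0∞} (hg : Measurable g) (hh : Measurable h) :
    iterNorm n p (fun v => g v * h v) ≤ iterNorm n a g * iterNorm n b h := by
  induction n with
  | zero => rfl
  | succ n ih =>
    refine le_trans ?_ (ih (p := Fin.tail p) (a := Fin.tail a) (b := Fin.tail b)
      (fun j => hp j.succ) (fun j => ha j.succ) (fun j => hb j.succ) (fun j => hab j.succ)
      (measurable_inner_norm hg (a 0)) (measurable_inner_norm hh (b 0)))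
    refine iterNorm_mono_ae (fun j => hp j.succ) (Filter.Eventually.of_forall fun y => ?_)
    refine ENNReal.lintegral_Lp_mul_le_Lq_mul_Lr (hp 0) ?_ (hab 0) _
      (measurable_comp_cons hg y).aemeasurable (measurable_comp_cons hh y).aemeasurable
    have := hab 0
    have h1 : 0 < 1 / b 0 := one_div_pos.2 (hb 0)
    exact (one_div_lt_one_div (ha 0) (hp 0)).1 (by linarith)

lemma iterNorm_const_exponent (n : ℕ) {P : ℝ} (hP : 0 < P) {g : (Fin n → ℝ) → ℝ≥0∞}
    (hg : Measurable g) : iterNorm n (fun _ => P) g = (∫⁻ v, g v ^ P) ^ (1 / P) := by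
  induction n with
  | zero =>
    have h : (volume : Measure (Fin 0 → ℝ)) = Measure.dirac Fin.elim0 := by
      rw [volume_pi]; exact Measure.pi_of_empty _ _
    rw [h, lintegral_dirac' _ (hg.pow_const _), ← ENNReal.rpow_mul, mul_one_div_cancel hP.ne',
      ENNReal.rpow_one, iterNorm]
  | succ n ih =>
    have : Fin.tail (fun _ : Fin (n + 1) => P) = fun _ => P := rfl
    rw [iterNorm, this, ih (measurable_inner_norm hg P), lintegral_cons (hg.pow_const P)]
    congr 1
    refine lintegral_congr fun y => ?_
    rw [← ENNReal.rpow_mul, one_div_mul_cancel hP.ne', ENNReal.rpow_one]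

lemma iterNorm_prod {n : ℕ} {p : Fin n → ℝ} (hp : ∀ j, 0 < p j) {u : Fin n → ℝ → ℝ≥0∞}
    (hu : ∀ j, Measurable (u j)) :
    iterNorm n p (fun v => ∏ j, u j (v j)) = ∏ j, (∫⁻ t, u j t ^ p j) ^ (1 / p j) := by
  induction n with
  | zero => simp [iterNorm]
  | succ n ih =>
    have h0 := hp 0
    rw [iterNorm, Fin.prod_univ_succ]
    have := ih (p := Fin.tail p) (u := fun j => u j.succ) (fun j => hp j.succ) (fun j => hu j.succ)
    rw [show (∏ j : Fin n, (∫⁻ t, u j.succ t ^ p j.succ) ^ (1 / p j.succ)) = _ from this.symm,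
      ← iterNorm_const_mul (p := Fin.tail p) (fun j => hp j.succ) _ (by fun_prop)]
    congr 1
    funext y
    simp_rw [Fin.prod_univ_succ, Fin.cons_zero, Fin.cons_succ,
      ENNReal.mul_rpow_of_nonneg _ _ h0.le]
    rw [lintegral_mul_const _ ((hu 0).pow_const _), ENNReal.mul_rpow_of_nonneg _ _ (by positivity),
      ← ENNReal.rpow_mul, mul_one_div_cancel h0.ne', ENNReal.rpow_one]

/-- Cubes are products, so their mixed norms are explicit. Balls are compared with inscribed and
circumscribed cubes. -/
lemma iterNorm_cube {n : ℕ} {p : Fin n → ℝ} (hp : ∀ j, 0 < p j) (x : Fin n → ℝ) {r : ℝ}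
    (hr : 0 < r) :
    iterNorm n p (fun v => ∏ j, (Set.Ioo (x j - r) (x j + r)).indicator 1 (v j)) =
      ENNReal.ofReal ((2 * r) ^ (∑ j, 1 / p j)) := by
  rw [iterNorm_prod hp (fun j => measurable_one.indicator measurableSet_Ioo),
    Real.rpow_sum_of_pos (by positivity), ENNReal.ofReal_prod_of_nonneg (fun j _ => by positivity)]
  refine Finset.prod_congr rfl fun j _ => ?_
  have : ∀ t : ℝ, ((Set.Ioo (x j - r) (x j + r)).indicator 1 t : ℝ≥0∞) ^ p j =
      (Set.Ioo (x j - r) (x j + r)).indicator 1 t := by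
    intro t
    by_cases ht : t ∈ Set.Ioo (x j - r) (x j + r) <;> simp [ht, hp j]
  simp_rw [this]
  rw [lintegral_indicator_one measurableSet_Ioo, Real.volume_Ioo,
    ENNReal.ofReal_rpow_of_nonneg (by linarith) (one_div_pos.2 (hp j)).le]
  congr 2
  ring

/-! ### The mixed norm of functions with values in `[0,∞]` -/

/-- The mixed Lebesgue (quasi-)norm of a function on `ℝⁿ` with values in `[0,∞]`. -/
def eMixedNorm {n : ℕ} (p : Fin n → ℝ) (g : Rn n → ℝ≥0∞) : ℝ≥0∞ :=
  iterNorm n p (fun v => g (WithLp.toLp 2 v))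

lemma mixedNorm_eq {n : ℕ} (p : Fin n → ℝ) (f : Rn n → ℂ) :
    mixedNorm p f = eMixedNorm p (fun x => ‖f x‖ₑ) := rfl

section
variable {n : ℕ} {p : Fin n → ℝ}

lemma eMixedNorm_mono_ae (hp : ∀ j, 0 < p j) {g h : Rn n → ℝ≥0∞} (hgh : ∀ᵐ x, g x ≤ h x) :
    eMixedNorm p g ≤ eMixedNorm p h :=
  iterNorm_mono_ae hp ((PiLp.volume_preserving_toLp (Fin n)).quasiMeasurePreserving.ae hgh)

lemma eMixedNorm_mono (hp : ∀ j, 0 < p j) {g h : Rn n → ℝ≥0∞} (hgh : ∀ x, g x ≤ h x) :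
    eMixedNorm p g ≤ eMixedNorm p h :=
  eMixedNorm_mono_ae hp (Filter.Eventually.of_forall hgh)

lemma eMixedNorm_congr_ae (hp : ∀ j, 0 < p j) {g h : Rn n → ℝ≥0∞} (hgh : g =ᵐ[volume] h) :
    eMixedNorm p g = eMixedNorm p h :=
  le_antisymm (eMixedNorm_mono_ae hp hgh.le) (eMixedNorm_mono_ae hp hgh.symm.le)

lemma eMixedNorm_const_mul (hp : ∀ j, 0 < p j) (c : ℝ≥0∞) {g : Rn n → ℝ≥0∞}
    (hg : AEMeasurable g) : eMixedNorm p (fun x => c * g x) = c * eMixedNorm p g := by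
  rw [eMixedNorm_congr_ae hp hg.ae_eq_mk, eMixedNorm_congr_ae hp
    (show (fun x => c * g x) =ᵐ[volume] fun x => c * hg.mk g x by
      filter_upwards [hg.ae_eq_mk] with x hx using by rw [hx])]
  exact iterNorm_const_mul hp c
    (hg.measurable_mk.comp (PiLp.volume_preserving_toLp (Fin n)).measurable)

lemma exists_eMixedNorm_add_le (hp : ∀ j, 0 < p j) :
    ∃ K : ℝ≥0, ∀ g h : Rn n → ℝ≥0∞, AEMeasurable g → AEMeasurable h →
      eMixedNorm p (fun x => g x + h x) ≤ K * (eMixedNorm p g + eMixedNorm p h) := by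
  obtain ⟨K, hK⟩ := exists_iterNorm_add_le hp
  refine ⟨K, fun g h hg hh => ?_⟩
  rw [eMixedNorm_congr_ae hp hg.ae_eq_mk, eMixedNorm_congr_ae hp hh.ae_eq_mk,
    eMixedNorm_congr_ae hp (show (fun x => g x + h x) =ᵐ[volume] fun x => hg.mk g x + hh.mk h x by
      filter_upwards [hg.ae_eq_mk, hh.ae_eq_mk] with x hx hx' using by rw [hx, hx'])]
  exact hK _ _ (hg.measurable_mk.comp (PiLp.volume_preserving_toLp (Fin n)).measurable)
    (hh.measurable_mk.comp (PiLp.volume_preserving_toLp (Fin n)).measurable)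

lemma eMixedNorm_mul_le {a b : Fin n → ℝ} (hp : ∀ j, 0 < p j) (ha : ∀ j, 0 < a j)
    (hb : ∀ j, 0 < b j) (hab : ∀ j, 1 / p j = 1 / a j + 1 / b j)
    {g h : Rn n → ℝ≥0∞} (hg : AEMeasurable g) (hh : AEMeasurable h) :
    eMixedNorm p (fun x => g x * h x) ≤ eMixedNorm a g * eMixedNorm b h := by
  rw [eMixedNorm_congr_ae ha hg.ae_eq_mk, eMixedNorm_congr_ae hb hh.ae_eq_mk,
    eMixedNorm_congr_ae hp (show (fun x => g x * h x) =ᵐ[volume] fun x => hg.mk g x * hh.mk h x by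
      filter_upwards [hg.ae_eq_mk, hh.ae_eq_mk] with x hx hx' using by rw [hx, hx'])]
  exact iterNorm_mul_le hp ha hb hab
    (hg.measurable_mk.comp (PiLp.volume_preserving_toLp (Fin n)).measurable)
    (hh.measurable_mk.comp (PiLp.volume_preserving_toLp (Fin n)).measurable)

lemma eMixedNorm_const_exponent {P : ℝ} (hP : 0 < P) {g : Rn n → ℝ≥0∞} (hg : AEMeasurable g) :
    eMixedNorm (fun _ => P) g = (∫⁻ x, g x ^ P) ^ (1 / P) := by
  rw [eMixedNorm_congr_ae (fun _ => hP) hg.ae_eq_mk, lintegral_congr_ae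
    (show (fun x => g x ^ P) =ᵐ[volume] fun x => hg.mk g x ^ P by
      filter_upwards [hg.ae_eq_mk] with x hx using by rw [hx]),
    ← (PiLp.volume_preserving_toLp (Fin n)).lintegral_comp (hg.measurable_mk.pow_const P)]
  exact iterNorm_const_exponent n hP
    (hg.measurable_mk.comp (PiLp.volume_preserving_toLp (Fin n)).measurable)

lemma eMixedNorm_ball_le (hp : ∀ j, 0 < p j) (x : Rn n) {r : ℝ} (hr : 0 < r) :
    eMixedNorm p ((Metric.ball x r).indicator 1) ≤
      ENNReal.ofReal ((2 * r) ^ (∑ j, 1 / p j)) := by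
  rw [← iterNorm_cube hp (fun j => x j) hr]
  refine iterNorm_mono_ae hp (Filter.Eventually.of_forall fun v => ?_)
  by_cases hv : WithLp.toLp 2 v ∈ Metric.ball x r
  · have h : ∀ j, v j ∈ Set.Ioo (x j - r) (x j + r) := by
      intro j
      have h1 := PiLp.norm_apply_le (WithLp.toLp 2 v - x) j
      rw [Metric.mem_ball, dist_eq_norm] at hv
      have h2 : |v j - x j| < r := lt_of_le_of_lt (by simpa using h1) hv
      rw [abs_lt] at h2
      constructor <;> linarith [h2.1, h2.2]
    simp [hv, h]
  · simp [hv]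

lemma le_eMixedNorm_ball (hp : ∀ j, 0 < p j) (x : Rn n) {r : ℝ} (hr : 0 < r) :
    ENNReal.ofReal ((2 * (r / (n + 1))) ^ (∑ j, 1 / p j)) ≤
      eMixedNorm p ((Metric.ball x r).indicator 1) := by
  have hn : (0 : ℝ) < n + 1 := by positivity
  rw [← iterNorm_cube hp (fun j => x j) (by positivity : 0 < r / (n + 1))]
  refine iterNorm_mono_ae hp (Filter.Eventually.of_forall fun v => ?_)
  by_cases hv : ∀ j, v j ∈ Set.Ioo (x j - r / (n + 1)) (x j + r / (n + 1))
  · have h : WithLp.toLp 2 v ∈ Metric.ball x r := by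
      rw [Metric.mem_ball, dist_eq_norm, EuclideanSpace.norm_eq]
      have h1 : ∀ j, ‖(WithLp.toLp 2 v - x) j‖ ≤ r / (n + 1) := by
        intro j
        rw [Real.norm_eq_abs, abs_le]
        have := hv j
        constructor <;> simp <;> linarith [this.1, this.2]
      -- The `ℓ²` norm is at most the `ℓ¹` norm. The half-side `r / (n + 1)` makes the final
      -- inequality strict and stays meaningful for `n = 0`.
      calc _ ≤ ∑ j, ‖(WithLp.toLp 2 v - x) j‖ := by
            refine Real.sqrt_le_iff.2 ⟨Finset.sum_nonneg fun _ _ => norm_nonneg _, ?_⟩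
            exact Finset.sum_sq_le_sq_sum_of_nonneg (fun _ _ => norm_nonneg _)
        _ ≤ ∑ j : Fin n, r / (n + 1) := Finset.sum_le_sum fun j _ => h1 j
        _ = n * (r / (n + 1)) := by simp
        _ < r := by
            rw [← mul_div_assoc, div_lt_iff₀ hn]
            linarith
    have h3 : ∏ j, (Set.Ioo (x j - r / (n + 1)) (x j + r / (n + 1))).indicator 1 (v j) =
        (1 : ℝ≥0∞) :=
      Finset.prod_eq_one fun j _ => by rw [Set.indicator_of_mem (hv j)]; rfl
    simp [h, h3]
  · push Not at hv
    obtain ⟨j, hj⟩ := hv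
    rw [Finset.prod_eq_zero (Finset.mem_univ j) (Set.indicator_of_notMem hj _)]
    exact zero_le

end

/-! ### Functions of bounded mean oscillation -/

section BMO
open Metric

/-- The mean of `b` over the ball `B(x,r)`. -/
def ballMean {n : ℕ} (b : Rn n → ℂ) (x : Rn n) (r : ℝ) : ℂ := ⨍ z in ball x r, b z

/-- The mean oscillation of `b` over each ball is at most `A`. -/
def OscillationLE {n : ℕ} (b : Rn n → ℂ) (A : ℝ≥0) : Prop :=
  ∀ x r, 0 < r → ∫⁻ y in ball x r, ‖b y - ballMean b x r‖ₑ ≤ A * volume (ball x r)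

lemma volume_ball_pos {n : ℕ} (x : Rn n) {r : ℝ} (hr : 0 < r) : volume (ball x r) ≠ 0 :=
  (measure_ball_pos volume x hr).ne'

lemma volume_ball_ne_top {n : ℕ} (x : Rn n) (r : ℝ) : volume (ball x r) ≠ ∞ :=
  measure_ball_lt_top.ne

lemma volume_ball_mul {n : ℕ} (x y : Rn n) {s : ℝ≥0} (hs : 0 < s) (r : ℝ) :
    volume (ball x (s * r)) = s ^ n * volume (ball y r) := by
  rw [Measure.addHaar_ball_mul_of_pos _ x (by exact_mod_cast hs), ← Measure.addHaar_ball_center _ y]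
  congr 1
  rw [ENNReal.ofReal_pow (by positivity)]
  simp

lemma MemBMO.exists_oscillationLE {n : ℕ} {b : Rn n → ℂ} (hb : MemBMO b) :
    ∃ A : ℝ≥0, OscillationLE b A := by
  obtain ⟨A, hA⟩ := ENNReal.lt_iff_exists_coe.1 hb.2 |>.imp fun _ h => h.1
  refine ⟨A, fun x r hr => ?_⟩
  rw [← hA, mul_comm, ← ENNReal.inv_mul_le_iff (volume_ball_pos x hr) (volume_ball_ne_top x r)]
  exact le_iSup_of_le x (le_iSup_of_le r (le_iSup_of_le hr le_rfl))

variable {n : ℕ} {b : Rn n → ℂ} {A : ℝ≥0}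

lemma integrableOn_ball (hb : LocallyIntegrable b) (x : Rn n) (r : ℝ) :
    IntegrableOn b (ball x r) :=
  (hb.integrableOn_isCompact (isCompact_closedBall x r)).mono_set ball_subset_closedBall

/-- The difference is the average of `b - c`. This serves both to compare means over nested balls
and, read as a lower bound for the integral, to bound the total volume of the stopping balls. -/
lemma enorm_ballMean_sub_le (hb : LocallyIntegrable b) (c : ℂ) (x : Rn n) {r : ℝ} (hr : 0 < r) :
    ‖ballMean b x r - c‖ₑ * volume (ball x r) ≤ ∫⁻ y in ball x r, ‖b y - c‖ₑ := by
  have h1 : (volume.real (ball x r) : ℂ) * (ballMean b x r - c) = ∫ y in ball x r, (b y - c) := by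
    rw [integral_sub (integrableOn_ball hb x r) (by
        exact integrableOn_const (volume_ball_ne_top x r)), setIntegral_const, ballMean,
      setAverage_eq]
    have : (volume.real (ball x r) : ℂ) ≠ 0 := by
      rw [measureReal_def]
      exact_mod_cast (ENNReal.toReal_ne_zero.2 ⟨volume_ball_pos x hr, volume_ball_ne_top x r⟩)
    simp only [Complex.real_smul]
    push_cast
    field_simp
  calc ‖ballMean b x r - c‖ₑ * volume (ball x r)
      = ‖(volume.real (ball x r) : ℂ) * (ballMean b x r - c)‖ₑ := by
        rw [enorm_mul, mul_comm]
        congr 1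
        rw [← ofReal_norm, Complex.norm_real, Real.norm_of_nonneg measureReal_nonneg,
          measureReal_def, ENNReal.ofReal_toReal (volume_ball_ne_top x r)]
    _ ≤ _ := by rw [h1]; exact enorm_integral_le_lintegral_enorm _

lemma enorm_ballMean_sub_ballMean_le (hb : LocallyIntegrable b) (hA : OscillationLE b A)
    {x y : Rn n} {r : ℝ} (hr : 0 < r) {s : ℝ≥0} (hs : 0 < s) (hsub : ball x r ⊆ ball y (s * r)) :
    ‖ballMean b x r - ballMean b y (s * r)‖ₑ ≤ s ^ n * A := by
  have hv := volume_ball_pos x hr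
  have hv' := volume_ball_ne_top x r
  refine (ENNReal.mul_le_mul_iff_left hv hv').1 ?_
  calc _ ≤ ∫⁻ z in ball x r, ‖b z - ballMean b y (s * r)‖ₑ := enorm_ballMean_sub_le hb _ x hr
    _ ≤ ∫⁻ z in ball y (s * r), ‖b z - ballMean b y (s * r)‖ₑ := lintegral_mono_set hsub
    _ ≤ A * volume (ball y (s * r)) := hA y _ (by positivity)
    _ = s ^ n * A * volume (ball x r) := by rw [volume_ball_mul y x hs]; ring

lemma enorm_sub_le_add (a c d : ℂ) : ‖a - d‖ₑ ≤ ‖a - c‖ₑ + ‖c - d‖ₑ := by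
  simpa using enorm_add_le (a - c) (c - d)

lemma lintegral_double_ball_le (hb : LocallyIntegrable b) (hA : OscillationLE b A)
    (x : Rn n) {r : ℝ} (hr : 0 < r) :
    ∫⁻ y in ball x (2 * r), ‖b y - ballMean b x r‖ₑ ≤
      ((1 + 2 ^ n) * 2 ^ n * A : ℝ≥0) * volume (ball x r) := by
  have h2 : ‖ballMean b x (2 * r) - ballMean b x r‖ₑ ≤ 2 ^ n * A := by
    rw [enorm_sub_rev]
    simpa using enorm_ballMean_sub_ballMean_le hb hA (x := x) (y := x) hr (s := 2) (by norm_num)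
      (ball_subset_ball (by simp; linarith))
  have hv : volume (ball x (2 * r)) = 2 ^ n * volume (ball x r) := by
    simpa using volume_ball_mul x x (s := 2) (by norm_num) r
  calc _ ≤ ∫⁻ y in ball x (2 * r), (‖b y - ballMean b x (2 * r)‖ₑ + 2 ^ n * A) := by
        refine lintegral_mono fun y => (enorm_sub_le_add _ (ballMean b x (2 * r)) _).trans ?_
        gcongr
    _ = (∫⁻ y in ball x (2 * r), ‖b y - ballMean b x (2 * r)‖ₑ) +
          2 ^ n * A * volume (ball x (2 * r)) := by
        rw [lintegral_add_right _ measurable_const, setLIntegral_const]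
    _ ≤ A * volume (ball x (2 * r)) + 2 ^ n * A * volume (ball x (2 * r)) := by
        gcongr
        exact hA x _ (by positivity)
    _ = _ := by
        rw [hv]
        push_cast
        ring

/-- Lebesgue differentiation along dyadic radii. The differentiation theorem is about closed balls;
the bounding spheres are null. -/
lemma ae_tendsto_ballMean (hb : LocallyIntegrable b) :
    ∀ᵐ x, ∀ r : ℝ, 0 < r →
      Filter.Tendsto (fun k : ℕ => ballMean b x (2⁻¹ ^ k * r)) Filter.atTop (nhds (b x)) := by
  filter_upwards [IsUnifLocDoublingMeasure.ae_tendsto_average (μ := volume) hb 1] with x hx r hr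
  have hpos : ∀ k : ℕ, 0 < (2⁻¹ : ℝ) ^ k * r := fun k => by positivity
  have h := hx (l := (Filter.atTop : Filter ℕ)) (fun _ => x) (fun k : ℕ => (2⁻¹ : ℝ) ^ k * r) ?_ ?_
  · refine h.congr fun k => ?_
    refine setAverage_congr ?_
    exact (ae_eq_set.2 ⟨by
        rw [closedBall_sdiff_ball, Measure.addHaar_sphere_of_ne_zero _ _ (hpos k).ne'],
      by simp [Set.sdiff_eq_empty.2 ball_subset_closedBall]⟩)
  · refine tendsto_nhdsWithin_iff.2 ⟨?_, Filter.Eventually.of_forall hpos⟩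
    simpa using (tendsto_pow_atTop_nhds_zero_of_lt_one (r := (2⁻¹ : ℝ)) (by norm_num)
      (by norm_num)).mul_const r
  · exact Filter.Eventually.of_forall fun k => mem_closedBall_self (by linarith [hpos k])

/-- Selection of the stopping radius. -/
lemma exists_stopping_radius (hb : LocallyIntegrable b) (hA : OscillationLE b A)
    {x y : Rn n} {r : ℝ} (hr : 0 < r) (hy : y ∈ ball x r)
    (hlim : Filter.Tendsto (fun k : ℕ => ballMean b y (2⁻¹ ^ k * r)) Filter.atTop (nhds (b y)))
    {l : ℝ≥0} (hl : 2 * 2 ^ n * A ≤ l) (hbad : (l : ℝ≥0∞) < ‖b y - ballMean b x r‖ₑ) :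
    ∃ s, 0 < s ∧ s ≤ r ∧ (l : ℝ≥0∞) < ‖ballMean b y s - ballMean b x r‖ₑ ∧
      ‖ballMean b y (2 * s) - ballMean b x r‖ₑ ≤ l := by
  have hex : ∃ k : ℕ, (l : ℝ≥0∞) < ‖ballMean b y (2⁻¹ ^ k * r) - ballMean b x r‖ₑ :=
    ((hlim.sub_const _).enorm.eventually_const_lt hbad).exists
  classical
  -- The stopping index is the first bad one. It is not 0: `B(x,r)` and `B(y,r)` both lie in
  -- `B(x,2r)`, so their means differ by at most `2 * 2 ^ n * A ≤ l`. Hence the previous radius,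
  -- twice as large, is still good.
  have h0 : Nat.find hex ≠ 0 := by
    intro h
    have h1 := Nat.find_spec hex
    rw [h] at h1
    simp only [pow_zero, one_mul] at h1
    refine absurd h1 (not_lt.2 ?_)
    have hc : ball x r ⊆ ball x (2 * r) := ball_subset_ball (by linarith)
    have hc' : ball y r ⊆ ball x (2 * r) := by
      refine ball_subset_ball' ?_
      rw [mem_ball] at hy
      linarith
    have e1 := enorm_ballMean_sub_ballMean_le hb hA (x := x) (y := x) hr (s := 2) (by norm_num)
      (by simpa using hc)
    have e2 := enorm_ballMean_sub_ballMean_le hb hA (x := y) (y := x) hr (s := 2) (by norm_num)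
      (by simpa using hc')
    rw [enorm_sub_rev] at e1
    calc _ ≤ _ := enorm_sub_le_add _ _ _
      _ ≤ _ := add_le_add e2 e1
      _ = ((2 * 2 ^ n * A : ℝ≥0) : ℝ≥0∞) := by push_cast; ring
      _ ≤ l := by exact_mod_cast hl
  obtain ⟨k, hk⟩ := Nat.exists_eq_succ_of_ne_zero h0
  refine ⟨2⁻¹ ^ Nat.find hex * r, by positivity, ?_, Nat.find_spec hex, ?_⟩
  · exact mul_le_of_le_one_left hr.le (pow_le_one₀ (by norm_num) (by norm_num))
  · have := Nat.find_min hex (m := k) (by omega)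
    rw [not_lt] at this
    rwa [hk, show (2 : ℝ) * (2⁻¹ ^ k.succ * r) = 2⁻¹ ^ k * r by rw [pow_succ]; ring]

/-- The **John–Nirenberg inequality** on balls. -/
theorem exists_volume_oscillation_le (hb : LocallyIntegrable b) (hA : OscillationLE b A) :
    ∃ K : ℝ≥0, 0 < K ∧ ∀ (j : ℕ) (x : Rn n) (r : ℝ), 0 < r →
      volume {y ∈ ball x r | (j * K : ℝ≥0) < ‖b y - ballMean b x r‖ₑ} ≤
        2⁻¹ ^ j * volume (ball x r) := by
  -- Here `4 ^ n` is the Vitali enlargement, the bracket is the constant of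
  -- `lintegral_double_ball_le`, and the factor 2 yields the gain `1/2` at each level. The summand 1
  -- keeps `l` positive when `A = 0`.
  set l : ℝ≥0 := 2 * 4 ^ n * ((1 + 2 ^ n) * 2 ^ n * A) + 1 with hl
  have hl2 : 2 * 2 ^ n * A ≤ l := by
    have h4 : (1 : ℝ≥0) ≤ 4 ^ n := one_le_pow₀ (by norm_num)
    calc 2 * 2 ^ n * A = 2 * 1 * ((1 + 0) * 2 ^ n * A) := by ring
      _ ≤ 2 * 4 ^ n * ((1 + 2 ^ n) * 2 ^ n * A) := by gcongr; positivity
      _ ≤ l := by simp [hl]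
  refine ⟨l + 2 ^ n * A, by positivity, fun j => ?_⟩
  set K : ℝ≥0 := l + 2 ^ n * A with hK
  -- The hypothesis at level `j` is needed for all balls, since it is applied to the enlarged
  -- stopping balls.
  induction j with
  | zero =>
    intro x r _
    rw [pow_zero, one_mul]
    exact measure_mono (Set.sep_subset _ _)
  | succ j ih =>
    intro x r hr
    set c := ballMean b x r with hc
    set t : Set (Rn n) := {y ∈ ball x r | ((j + 1 : ℕ) * K : ℝ≥0) < ‖b y - c‖ₑ ∧
      Filter.Tendsto (fun k : ℕ => ballMean b y (2⁻¹ ^ k * r)) Filter.atTop (nhds (b y))} with ht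
    have hae : volume {y ∈ ball x r | ((j + 1 : ℕ) * K : ℝ≥0) < ‖b y - c‖ₑ} ≤ volume t := by
      refine measure_mono_ae ?_
      filter_upwards [ae_tendsto_ballMean hb] with y hy hy'
      exact ⟨hy'.1, hy'.2, hy r hr⟩
    refine hae.trans ?_
    have hradius : ∀ y : Rn n, ∃ s : ℝ, y ∈ t → 0 < s ∧ s ≤ r ∧
        (l : ℝ≥0∞) < ‖ballMean b y s - c‖ₑ ∧ ‖ballMean b y (2 * s) - c‖ₑ ≤ l := by
      intro y
      by_cases hy : y ∈ t
      · obtain ⟨s, hs⟩ := exists_stopping_radius hb hA hr hy.1 hy.2.2 hl2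
          (lt_of_le_of_lt (by
            norm_cast
            calc l ≤ K := by simp [hK]
              _ ≤ (j + 1 : ℕ) * K := le_mul_of_one_le_left (by positivity) (by simp)) hy.2.1)
        exact ⟨s, fun _ => hs⟩
      · exact ⟨0, fun h => absurd h hy⟩
    choose s hs using hradius
    -- Vitali covering of the bad points by fourfold enlargements of disjoint stopping balls; any
    -- factor above 3 is admissible.
    obtain ⟨u, hut, hdisj, hcov⟩ := Vitali.exists_disjoint_subfamily_covering_enlargement_ball t
      id s r (fun y hy => (hs y hy).2.1) 4 (by norm_num)
    have hcount : u.Countable := hdisj.countable_of_isOpen (fun _ _ => isOpen_ball)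
      (fun y hy => nonempty_ball.2 (hs y (hut hy)).1)
    have hsub : t ⊆ ⋃ z ∈ u, {y ∈ ball z (4 * s z) |
        (j * K : ℝ≥0) < ‖b y - ballMean b z (4 * s z)‖ₑ} := by
      intro y hy
      obtain ⟨z, hz, hyz⟩ := hcov y hy
      refine Set.mem_biUnion hz ⟨hyz (mem_ball_self (hs y hy).1), ?_⟩
      have hz' := hs z (hut hz)
      -- The mean over `B(z, 2s)` is within `l` of `c`, and one doubling costs `2 ^ n * A`; this
      -- dictates `K`. A deviation above `(j + 1) K` from `c` thus leaves more than `j K` from the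
      -- new mean.
      have e1 : ‖ballMean b z (4 * s z) - c‖ₑ ≤ K := by
        have e := enorm_ballMean_sub_ballMean_le hb hA (x := z) (y := z) (r := 2 * s z)
          (by linarith [hz'.1]) (s := 2) (by norm_num)
          (ball_subset_ball (by simp; linarith [hz'.1]))
        have e4 : ((2 : ℝ≥0) : ℝ) * (2 * s z) = 4 * s z := by push_cast; ring
        rw [e4, enorm_sub_rev] at e
        calc _ ≤ _ := enorm_sub_le_add _ _ _
          _ ≤ _ := add_le_add e hz'.2.2.2
          _ = K := by rw [hK]; push_cast; ring
      by_contra hcon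
      rw [not_lt] at hcon
      have := hy.2.1
      refine absurd this (not_lt.2 ?_)
      calc ‖b y - c‖ₑ ≤ _ := enorm_sub_le_add _ (ballMean b z (4 * s z)) _
        _ ≤ _ := add_le_add hcon e1
        _ = ((j + 1 : ℕ) * K : ℝ≥0) := by push_cast; ring
    -- On each stopping ball the average of `|b - c|` exceeds `l`, and these disjoint balls lie in
    -- `B(x,2r)`.
    have hsum : ∑' z : u, volume (ball (z : Rn n) (s z)) ≤
        (l : ℝ≥0∞)⁻¹ * (((1 + 2 ^ n) * 2 ^ n * A : ℝ≥0) * volume (ball x r)) := by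
      have hl0 : (l : ℝ≥0∞) ≠ 0 := by simp [hl]
      rw [← ENNReal.mul_le_iff_le_inv hl0 ENNReal.coe_ne_top, ← ENNReal.tsum_mul_left]
      calc ∑' z : u, (l : ℝ≥0∞) * volume (ball (z : Rn n) (s z))
          ≤ ∑' z : u, ∫⁻ y in ball (z : Rn n) (s z), ‖b y - c‖ₑ := by
            refine ENNReal.tsum_le_tsum fun z => ?_
            have hz := hs z (hut z.2)
            refine le_trans ?_ (enorm_ballMean_sub_le hb c (z : Rn n) hz.1)
            gcongr
            exact hz.2.2.1.le
        _ = ∫⁻ y in ⋃ z ∈ u, ball z (s z), ‖b y - c‖ₑ :=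
            (lintegral_biUnion hcount (fun _ _ => measurableSet_ball) hdisj _).symm
        _ ≤ ∫⁻ y in ball x (2 * r), ‖b y - c‖ₑ := by
            refine lintegral_mono_set (Set.iUnion₂_subset fun z hz => ball_subset_ball' ?_)
            have h1 := (hut hz).1
            rw [mem_ball] at h1
            linarith [(hs z (hut hz)).2.1]
        _ ≤ _ := lintegral_double_ball_le hb hA x hr
    calc volume t ≤ ∑' z : u, volume {y ∈ ball (z : Rn n) (4 * s z) |
          (j * K : ℝ≥0) < ‖b y - ballMean b z (4 * s z)‖ₑ} :=
          (measure_mono hsub).trans (measure_biUnion_le volume hcount _)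
      _ ≤ ∑' z : u, 2⁻¹ ^ j * (4 ^ n * volume (ball (z : Rn n) (s z))) := by
          refine ENNReal.tsum_le_tsum fun z => ?_
          have e := volume_ball_mul (z : Rn n) z (s := 4) (by norm_num) (s z)
          have := ih z (4 * s z) (by linarith [(hs z (hut z.2)).1])
          refine this.trans_eq ?_
          rw [show (4 : ℝ) * s z = ((4 : ℝ≥0) : ℝ) * s z by simp, e]
          simp
      _ = 2⁻¹ ^ j * (4 ^ n * ∑' z : u, volume (ball (z : Rn n) (s z))) := by
          rw [ENNReal.tsum_mul_left, ENNReal.tsum_mul_left]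
      _ ≤ 2⁻¹ ^ j * (4 ^ n * ((l : ℝ≥0∞)⁻¹ *
            (((1 + 2 ^ n) * 2 ^ n * A : ℝ≥0) * volume (ball x r)))) := by gcongr
      _ = 2⁻¹ ^ j * ((4 ^ n * (l⁻¹ * ((1 + 2 ^ n) * 2 ^ n * A)) : ℝ≥0) * volume (ball x r)) := by
          rw [← ENNReal.coe_inv (by positivity)]
          push_cast
          ring_nf
      _ ≤ 2⁻¹ ^ j * ((2⁻¹ : ℝ≥0) * volume (ball x r)) := by
          gcongr
          rw [show 4 ^ n * (l⁻¹ * ((1 + 2 ^ n) * 2 ^ n * A)) =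
            (4 ^ n * ((1 + 2 ^ n) * 2 ^ n * A)) / l by rw [div_eq_mul_inv]; ring,
            div_le_iff₀ (by positivity)]
          rw [hl, mul_add, mul_assoc 2, ← mul_assoc 2⁻¹, inv_mul_cancel₀ two_ne_zero, one_mul]
          exact le_self_add
      _ = _ := by
          rw [pow_succ, mul_assoc]
          simp

/-- A discrete layer-cake bound: `g^P ≤ ∑ ((j+1)K)^P 1_{g > jK}`, where John–Nirenberg makes the
integrated series converge. -/
lemma exists_lintegral_oscillation_pow_le (hb : LocallyIntegrable b) (hA : OscillationLE b A)
    {P : ℕ} (hP : P ≠ 0) :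
    ∃ C : ℝ≥0, ∀ (x : Rn n) (r : ℝ), 0 < r →
      ∫⁻ y in ball x r, ‖b y - ballMean b x r‖ₑ ^ P ≤ C * volume (ball x r) := by
  obtain ⟨K, hK, hJN⟩ := exists_volume_oscillation_le hb hA
  have hsum : Summable (fun j : ℕ => ((j + 1 : ℕ) * K) ^ P * (2⁻¹ : ℝ≥0) ^ j) := by
    have h1 : Summable (fun j : ℕ => ((j + 1 : ℕ) : ℝ) ^ P * (2⁻¹ : ℝ) ^ (j + 1)) :=
      (summable_nat_add_iff 1).2
        (summable_pow_mul_geometric_of_norm_lt_one (R := ℝ) P (r := 2⁻¹) (by norm_num))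
    rw [← NNReal.summable_coe]
    refine (h1.mul_left (2 * (K : ℝ) ^ P)).congr fun j => ?_
    push_cast
    rw [pow_succ, mul_pow]
    ring
  refine ⟨∑' j : ℕ, ((j + 1 : ℕ) * K) ^ P * (2⁻¹ : ℝ≥0) ^ j, fun x r hr => ?_⟩
  set g : Rn n → ℝ≥0∞ := fun y => ‖b y - ballMean b x r‖ₑ with hg
  have hgm : AEMeasurable g :=
    (hb.aestronglyMeasurable.sub aestronglyMeasurable_const).enorm
  have hset : ∀ j : ℕ, NullMeasurableSet {y | ((j * K : ℝ≥0) : ℝ≥0∞) < g y} volume := fun j =>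
    nullMeasurableSet_lt aemeasurable_const hgm
  calc ∫⁻ y in ball x r, g y ^ P
      ≤ ∫⁻ y in ball x r, ∑' j : ℕ, {y | ((j * K : ℝ≥0) : ℝ≥0∞) < g y}.indicator
          (fun _ => ((((j + 1 : ℕ) * K) ^ P : ℝ≥0) : ℝ≥0∞)) y := by
        refine lintegral_mono fun y => ?_
        rcases eq_or_ne (g y) 0 with h0 | h0
        · simp [h0, hP]
        have htop : g y ≠ ∞ := by simp [hg]
        obtain ⟨v, hv : (v : ℝ≥0∞) = g y⟩ := WithTop.ne_top_iff_exists.1 htop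
        have hv0 : 0 < v := by
          rw [pos_iff_ne_zero]
          rintro rfl
          exact h0 (by simpa using hv.symm)
        obtain ⟨j, hj⟩ : ∃ j : ℕ, j * K < v ∧ v ≤ (j + 1 : ℕ) * K := by
          classical
          have hex : ∃ j : ℕ, v ≤ j * K := by
            obtain ⟨j, hj⟩ := exists_nat_ge (v / K)
            exact ⟨j, (div_le_iff₀ hK).1 hj⟩
          have hne : Nat.find hex ≠ 0 := by
            intro h
            have := Nat.find_spec hex
            rw [h] at this
            simp at this
            exact hv0.ne' this
          obtain ⟨k, hk⟩ := Nat.exists_eq_succ_of_ne_zero hne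
          refine ⟨k, not_le.1 (Nat.find_min hex (by omega)), ?_⟩
          have := Nat.find_spec hex
          rwa [hk] at this
        refine le_trans ?_ (ENNReal.le_tsum j)
        rw [Set.indicator_of_mem (by
          show ((j * K : ℝ≥0) : ℝ≥0∞) < g y
          rw [← hv]
          exact_mod_cast hj.1), ← hv]
        norm_cast
        gcongr
        exact hj.2
    _ = ∑' j : ℕ, ∫⁻ y in ball x r, {y | ((j * K : ℝ≥0) : ℝ≥0∞) < g y}.indicator
          (fun _ => ((((j + 1 : ℕ) * K) ^ P : ℝ≥0) : ℝ≥0∞)) y :=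
        lintegral_tsum fun j => (aemeasurable_const.indicator₀ (hset j)).restrict
    _ ≤ ∑' j : ℕ, ((((j + 1 : ℕ) * K) ^ P * (2⁻¹ : ℝ≥0) ^ j : ℝ≥0) : ℝ≥0∞) *
          volume (ball x r) := by
        refine ENNReal.tsum_le_tsum fun j => ?_
        rw [lintegral_indicator_const₀ ((hset j).mono_ac Measure.absolutelyContinuous_restrict),
          Measure.restrict_apply₀' measurableSet_ball.nullMeasurableSet,
          ENNReal.coe_mul (_ ^ P), mul_assoc (_ : ℝ≥0∞)]
        gcongr
        refine le_trans (measure_mono ?_) ((hJN j x r hr).trans_eq ?_)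
        · rintro y ⟨h1, h2⟩
          exact ⟨h2, h1⟩
        · push_cast
          simp
    _ = _ := by
        rw [ENNReal.tsum_mul_right, ENNReal.coe_tsum hsum]

/-- Each doubling of the radius moves the mean by at most `2 ^ n * A`, and about `log₂(t/r)`
doublings lead from `r` to `t`. -/
lemma exists_enorm_ballMean_sub_le_log (hb : LocallyIntegrable b) (hA : OscillationLE b A) :
    ∃ C : ℝ≥0, ∀ (x : Rn n) (r t : ℝ), 0 < r → r ≤ t →
      ‖ballMean b x t - ballMean b x r‖ₑ ≤ C * ENNReal.ofReal (1 + Real.log (t / r)) := by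
  have hdy : ∀ (x : Rn n) (r : ℝ), 0 < r → ∀ k : ℕ,
      ‖ballMean b x (2 ^ k * r) - ballMean b x r‖ₑ ≤ (k * (2 ^ n * A) : ℝ≥0) := by
    intro x r hr k
    induction k with
    | zero => simp
    | succ k ih =>
      have e := enorm_ballMean_sub_ballMean_le hb hA (x := x) (y := x) (r := 2 ^ k * r)
        (by positivity) (s := 2) (by norm_num)
        (ball_subset_ball (by
          have : 0 < 2 ^ k * r := by positivity
          simp; linarith))
      rw [enorm_sub_rev, show ((2 : ℝ≥0) : ℝ) * (2 ^ k * r) = 2 ^ (k + 1) * r by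
        rw [pow_succ]; push_cast; ring] at e
      calc _ ≤ _ := enorm_sub_le_add _ _ _
        _ ≤ _ := add_le_add e ih
        _ = _ := by push_cast; ring
  refine ⟨2 * (2 ^ n * A), fun x r t hr hrt => ?_⟩
  have ht : 0 < t := hr.trans_le hrt
  obtain ⟨k, hk1, hk2⟩ := exists_nat_pow_near ((one_le_div hr).2 hrt) (one_lt_two (α := ℝ))
  have hpos : 0 < 2 ^ k * r := by positivity
  rw [le_div_iff₀ hr] at hk1
  rw [div_lt_iff₀ hr, pow_succ] at hk2
  -- This uses `log 2 > 1/2`.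
  have hklog : (k : ℝ) ≤ 2 * Real.log (t / r) := by
    have h1 : Real.log (2 ^ k) ≤ Real.log (t / r) :=
      Real.log_le_log (by positivity) ((le_div_iff₀ hr).2 hk1)
    rw [Real.log_pow] at h1
    have h2 := Real.log_two_gt_d9
    have h3 : (0 : ℝ) ≤ k := by positivity
    nlinarith
  -- The remaining ratio after `k` doublings, at most 2.
  set s : ℝ≥0 := ⟨t / (2 ^ k * r), by positivity⟩ with hs
  have hst : (s : ℝ) * (2 ^ k * r) = t := by
    change t / (2 ^ k * r) * (2 ^ k * r) = t
    field_simp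
  have hs0 : 0 < s := by
    rw [← NNReal.coe_pos]
    change 0 < t / (2 ^ k * r)
    positivity
  have hs2 : s ≤ 2 := by
    rw [← NNReal.coe_le_coe]
    change t / (2 ^ k * r) ≤ 2
    rw [div_le_iff₀ hpos]
    linarith
  have e := enorm_ballMean_sub_ballMean_le hb hA (x := x) (y := x) hpos hs0
    (ball_subset_ball (by rw [hst]; exact hk1))
  rw [hst, enorm_sub_rev] at e
  calc _ ≤ _ := enorm_sub_le_add _ (ballMean b x (2 ^ k * r)) _
    _ ≤ 2 ^ n * A + (k * (2 ^ n * A) : ℝ≥0) := by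
        refine add_le_add (e.trans ?_) (hdy x r hr k)
        gcongr
        exact_mod_cast hs2
    _ = ((2 ^ n * A : ℝ≥0) : ℝ≥0∞) * ENNReal.ofReal (1 + k) := by
        rw [ENNReal.ofReal_add zero_le_one (by positivity), ENNReal.ofReal_natCast]
        push_cast
        simp
        ring
    _ ≤ ((2 ^ n * A : ℝ≥0) : ℝ≥0∞) * ENNReal.ofReal (2 * (1 + Real.log (t / r))) := by
        gcongr
        linarith
    _ = _ := by
        rw [ENNReal.ofReal_mul zero_le_two]
        push_cast
        simp
        ring

lemma one_le_one_add_log {r t : ℝ} (hr : 0 < r) (hrt : r ≤ t) : 1 ≤ 1 + Real.log (t / r) := by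
  linarith [Real.log_nonneg ((one_le_div hr).2 hrt)]

/-- Oscillations over a ball, measured in a mixed norm. -/
lemma exists_eMixedNorm_oscillation_le (hb : LocallyIntegrable b) (hA : OscillationLE b A)
    {p : Fin n → ℝ} (hp : ∀ j, 0 < p j) :
    ∃ C : ℝ≥0, ∀ (x : Rn n) (r : ℝ), 0 < r →
      eMixedNorm p ((ball x r).indicator fun y => ‖b y - ballMean b x r‖ₑ) ≤
        C * ENNReal.ofReal (r ^ ∑ j, 1 / p j) := by
  -- An integer above every `p j`, so that `1 / a j = 1 / p j - 1 / P` defines positive Hölder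
  -- exponents. For the constant exponent `P` the mixed norm is the ordinary `L^P` norm.
  obtain ⟨P, hPp⟩ := exists_nat_gt (∑ j, p j)
  have hPj : ∀ j, p j < P := fun j =>
    (Finset.single_le_sum (fun k _ => (hp k).le) (Finset.mem_univ j)).trans_lt hPp
  have hP0 : (0 : ℝ) < P := (Finset.sum_nonneg fun k _ => (hp k).le).trans_lt hPp
  obtain ⟨C, hC⟩ := exists_lintegral_oscillation_pow_le hb hA (P := P) (by exact_mod_cast hP0.ne')
  set a : Fin n → ℝ := fun j => 1 / (1 / p j - 1 / P) with ha
  have ha' : ∀ j, 1 / a j = 1 / p j - 1 / P := fun j => by simp [ha]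
  have ha0 : ∀ j, 0 < a j := fun j =>
    one_div_pos.2 (sub_pos.2 (one_div_lt_one_div_of_lt (hp j) (hPj j)))
  have hP1 : (0 : ℝ) ≤ 1 / P := by positivity
  have hPne : P ≠ 0 := by exact_mod_cast hP0.ne'
  refine ⟨C ^ (1 / P : ℝ) * (Real.toNNReal (2 ^ ∑ _j : Fin n, (1 / P : ℝ)) *
    Real.toNNReal (2 ^ ∑ j, 1 / a j)), fun x r hr => ?_⟩
  set g : Rn n → ℝ≥0∞ := (ball x r).indicator fun y => ‖b y - ballMean b x r‖ₑ with hg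
  have hgm : AEMeasurable g :=
    (hb.aestronglyMeasurable.sub aestronglyMeasurable_const).enorm.indicator measurableSet_ball
  have hχ : AEMeasurable ((ball x r).indicator (1 : Rn n → ℝ≥0∞)) volume :=
    (measurable_one.indicator measurableSet_ball).aemeasurable
  have hgχ : g = fun y => g y * (ball x r).indicator 1 y := by
    funext y
    by_cases hy : y ∈ ball x r <;> simp only [hg, hy, Set.indicator_of_mem, Set.indicator_of_notMem,
      not_false_iff, Pi.one_apply, mul_one, mul_zero]
  have h1 : eMixedNorm (fun _ => (P : ℝ)) g ≤
      C ^ (1 / P : ℝ) * eMixedNorm (fun _ => (P : ℝ)) ((ball x r).indicator 1) := by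
    rw [eMixedNorm_const_exponent hP0 hgm, eMixedNorm_const_exponent hP0 hχ,
      ← ENNReal.coe_rpow_of_nonneg _ hP1, ENNReal.coe_rpow_of_nonneg _ hP1,
      ← ENNReal.mul_rpow_of_nonneg _ _ hP1]
    refine ENNReal.rpow_le_rpow ?_ hP1
    have e1 : ∀ y, g y ^ (P : ℝ) =
        (ball x r).indicator (fun y => ‖b y - ballMean b x r‖ₑ ^ P) y := by
      intro y
      by_cases hy : y ∈ ball x r <;> simp [hg, hy, hPne]
    have e2 : ∀ y, ((ball x r).indicator 1 y : ℝ≥0∞) ^ (P : ℝ) = (ball x r).indicator 1 y := by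
      intro y
      by_cases hy : y ∈ ball x r <;> simp [hy, hPne]
    simp_rw [e1, e2]
    rw [lintegral_indicator measurableSet_ball, lintegral_indicator_one measurableSet_ball]
    exact hC x r hr
  have hsum : (∑ _j : Fin n, (1 / P : ℝ)) + ∑ j, 1 / a j = ∑ j, 1 / p j := by
    rw [← Finset.sum_add_distrib]
    exact Finset.sum_congr rfl fun j _ => by rw [ha' j]; ring
  calc eMixedNorm p g = eMixedNorm p (fun y => g y * (ball x r).indicator 1 y) := by rw [← hgχ]
    _ ≤ eMixedNorm (fun _ => (P : ℝ)) g * eMixedNorm a ((ball x r).indicator 1) :=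
        eMixedNorm_mul_le hp (fun _ => hP0) ha0 (fun j => by rw [ha' j]; ring) hgm hχ
    _ ≤ (C ^ (1 / P : ℝ) * ENNReal.ofReal ((2 * r) ^ ∑ _j : Fin n, (1 / P : ℝ))) *
          ENNReal.ofReal ((2 * r) ^ ∑ j, 1 / a j) := by
        gcongr
        · refine h1.trans ?_
          gcongr
          exact eMixedNorm_ball_le (fun _ => hP0) x hr
        · exact eMixedNorm_ball_le ha0 x hr
    _ = _ := by
        rw [← hsum, Real.rpow_add hr, Real.mul_rpow zero_le_two hr.le,
          Real.mul_rpow zero_le_two hr.le, ENNReal.ofReal_mul (by positivity),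
          ENNReal.ofReal_mul (by positivity), ENNReal.ofReal_mul (by positivity)]
        push_cast
        rw [ENNReal.coe_rpow_of_nonneg _ hP1]
        simp only [ENNReal.ofReal]
        ring

/-- Deviations from the mean over a smaller concentric ball, measured in a mixed norm. -/
lemma exists_eMixedNorm_sub_ballMean_le (hb : LocallyIntegrable b) (hA : OscillationLE b A)
    {p : Fin n → ℝ} (hp : ∀ j, 0 < p j) :
    ∃ C : ℝ≥0, ∀ (x : Rn n) (r t : ℝ), 0 < r → r ≤ t →
      eMixedNorm p ((ball x t).indicator fun y => ‖b y - ballMean b x r‖ₑ) ≤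
        C * (ENNReal.ofReal (1 + Real.log (t / r)) * ENNReal.ofReal (t ^ ∑ j, 1 / p j)) := by
  obtain ⟨C1, hC1⟩ := exists_eMixedNorm_oscillation_le hb hA hp
  obtain ⟨C2, hC2⟩ := exists_enorm_ballMean_sub_le_log hb hA
  obtain ⟨K, hK⟩ := exists_eMixedNorm_add_le hp
  refine ⟨K * (C1 + C2 * Real.toNNReal (2 ^ ∑ j, 1 / p j)), fun x r t hr hrt => ?_⟩
  have ht : 0 < t := hr.trans_le hrt
  set L := ENNReal.ofReal (1 + Real.log (t / r)) with hL
  have hL1 : 1 ≤ L := by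
    rw [hL, ENNReal.one_le_ofReal]
    exact one_le_one_add_log hr hrt
  have hχ : AEMeasurable ((ball x t).indicator (1 : Rn n → ℝ≥0∞)) volume :=
    (measurable_one.indicator measurableSet_ball).aemeasurable
  calc _ ≤ eMixedNorm p (fun y => (ball x t).indicator (fun y => ‖b y - ballMean b x t‖ₑ) y +
          C2 * L * (ball x t).indicator 1 y) := by
        refine eMixedNorm_mono hp fun y => ?_
        by_cases hy : y ∈ ball x t
        · simp only [hy, Set.indicator_of_mem, Pi.one_apply, mul_one]
          exact (enorm_sub_le_add _ (ballMean b x t) _).trans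
            (add_le_add le_rfl (hC2 x r t hr hrt))
        · simp [hy]
    _ ≤ K * (eMixedNorm p ((ball x t).indicator fun y => ‖b y - ballMean b x t‖ₑ) +
          eMixedNorm p (fun y => C2 * L * (ball x t).indicator 1 y)) :=
        hK _ _ ((hb.aestronglyMeasurable.sub aestronglyMeasurable_const).enorm.indicator
          measurableSet_ball) (hχ.const_mul _)
    _ ≤ K * (C1 * (L * ENNReal.ofReal (t ^ ∑ j, 1 / p j)) +
          C2 * L * ENNReal.ofReal ((2 * t) ^ ∑ j, 1 / p j)) := by
        rw [eMixedNorm_const_mul hp _ hχ]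
        gcongr
        · refine (hC1 x t ht).trans ?_
          gcongr
          exact le_mul_of_one_le_left zero_le hL1
        · exact eMixedNorm_ball_le hp x ht
    _ = _ := by
        rw [Real.mul_rpow zero_le_two ht.le, ENNReal.ofReal_mul (by positivity)]
        push_cast
        simp only [ENNReal.ofReal]
        ring

end BMO

/-! ### Integrals of products and radial weights -/

lemma lintegral_pi_prod_of_measurable {E : Type*} [MeasureSpace E]
    [SigmaFinite (volume : Measure E)]
    {m : ℕ} {u : Fin m → E → ℝ≥0∞} (hu : ∀ k, Measurable (u k)) :
    ∫⁻ y : Fin m → E, ∏ k, u k (y k) = ∏ k, ∫⁻ x, u k x := by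
  induction m with
  | zero => simp [volume_pi]
  | succ m ih =>
    have h := (volume_preserving_piFinSuccAbove (fun _ : Fin (m + 1) => E) 0).symm
    rw [← h.lintegral_comp (by fun_prop), Fin.prod_univ_succ, ← ih fun k => hu k.succ]
    have hz : ∀ z : E × (Fin m → E),
        ∏ k, u k ((MeasurableEquiv.piFinSuccAbove (fun _ : Fin (m + 1) => E) 0).symm z k) =
          u 0 z.1 * ∏ k : Fin m, u k.succ (z.2 k) := by
      intro z
      rw [Fin.prod_univ_succ]
      simp [MeasurableEquiv.piFinSuccAbove, Fin.insertNthEquiv]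
    simp_rw [hz]
    exact lintegral_prod_mul (μ := volume) (ν := volume) (hu 0).aemeasurable
      (g := fun y : Fin m → E => ∏ k, u k.succ (y k))
      (Finset.measurable_prod _ fun k _ => (hu k.succ).comp (measurable_pi_apply k)).aemeasurable

lemma lintegral_pi_prod {E : Type*} [MeasureSpace E] [SigmaFinite (volume : Measure E)]
    {m : ℕ} {u : Fin m → E → ℝ≥0∞} (hu : ∀ k, AEMeasurable (u k)) :
    ∫⁻ y : Fin m → E, ∏ k, u k (y k) = ∏ k, ∫⁻ x, u k x := by
  have h : ∀ᵐ y : Fin m → E, ∀ k, u k (y k) = (hu k).mk (u k) (y k) := by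
    rw [ae_all_iff]
    exact fun k => (Measure.quasiMeasurePreserving_eval (fun _ => volume) k).ae (hu k).ae_eq_mk
  rw [lintegral_congr_ae (show _ =ᵐ[volume] fun y => ∏ k, (hu k).mk (u k) (y k) by
    filter_upwards [h] with y hy using Finset.prod_congr rfl fun k _ => hy k),
    lintegral_pi_prod_of_measurable fun k => (hu k).measurable_mk]
  exact Finset.prod_congr rfl fun k _ => (lintegral_congr_ae (hu k).ae_eq_mk).symm

lemma lintegral_Ioi_rpow {s c : ℝ} (hs : 0 < s) (hc : 0 < c) :
    ∫⁻ t in Set.Ioi c, ENNReal.ofReal (t ^ (-s - 1)) = ENNReal.ofReal (c ^ (-s) / s) := by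
  rw [← ofReal_integral_eq_lintegral_ofReal (integrableOn_Ioi_rpow_of_lt (by linarith) hc),
    integral_Ioi_rpow_of_lt (by linarith) hc]
  · congr 1
    rw [sub_add_cancel, neg_div_neg_eq]
  · filter_upwards [ae_restrict_mem measurableSet_Ioi] with t ht
    exact Real.rpow_nonneg (hc.trans ht).le _

/-- The weight `max(r, |y - x|)^{-n}`, as a superposition of characteristic functions of balls. -/
lemma lintegral_div_max_pow {n : ℕ} (hn : 1 ≤ n) {g : Rn n → ℝ≥0∞} (hg : AEMeasurable g)
    (x : Rn n) {r : ℝ} (hr : 0 < r) :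
    ∫⁻ y, g y / ENNReal.ofReal (max r (dist y x)) ^ n =
      ∫⁻ t in Set.Ioi r, ENNReal.ofReal (n * t ^ (-(n : ℝ) - 1)) *
        ∫⁻ y in Metric.ball x t, g y := by
  have hn0 : (0 : ℝ) < n := by exact_mod_cast hn
  have hk : Measurable fun t : ℝ => ENNReal.ofReal (n * t ^ (-(n : ℝ) - 1)) := by fun_prop
  have hset : MeasurableSet {z : Rn n × ℝ | dist z.1 x < z.2} :=
    measurableSet_lt (by fun_prop) (by fun_prop)
  -- The identity `ρ^{-n} = ∫_ρ^∞ n t^{-n-1} dt` with `ρ = max r |y - x|`, followed by Tonelli's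
  -- theorem.
  have h1 : ∀ y, g y / ENNReal.ofReal (max r (dist y x)) ^ n =
      ∫⁻ t in Set.Ioi r, g y * ((Set.Ioi (dist y x)).indicator
        (fun t => ENNReal.ofReal (n * t ^ (-(n : ℝ) - 1))) t) := by
    intro y
    have hmax : 0 < max r (dist y x) := lt_max_of_lt_left hr
    rw [lintegral_const_mul _ (hk.indicator measurableSet_Ioi), setLIntegral_indicator
      measurableSet_Ioi, Set.Ioi_inter_Ioi, max_comm (dist y x) r]
    simp_rw [ENNReal.ofReal_mul hn0.le]
    rw [lintegral_const_mul _ (by fun_prop), lintegral_Ioi_rpow hn0 hmax,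
      ← ENNReal.ofReal_mul hn0.le, div_eq_mul_inv, mul_div_cancel₀ _ hn0.ne', Real.rpow_neg hmax.le,
      Real.rpow_natCast, ENNReal.ofReal_inv_of_pos (by positivity), ENNReal.ofReal_pow hmax.le]
  simp_rw [h1]
  rw [lintegral_lintegral_swap]
  · refine lintegral_congr fun t => ?_
    rw [← lintegral_indicator measurableSet_ball, ← lintegral_const_mul' _ _
      ENNReal.ofReal_ne_top]
    refine lintegral_congr fun y => ?_
    by_cases hy : dist y x < t
    · rw [Set.indicator_of_mem (show t ∈ Set.Ioi (dist y x) from hy),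
        Set.indicator_of_mem (Metric.mem_ball.2 hy), mul_comm]
    · rw [Set.indicator_of_notMem (show t ∉ Set.Ioi (dist y x) from hy),
        Set.indicator_of_notMem (fun h => hy (Metric.mem_ball.1 h)), mul_zero, mul_zero]
  · have h2 : AEMeasurable (fun z : Rn n × ℝ => g z.1)
        (volume.prod (volume.restrict (Set.Ioi r))) := hg.comp_fst
    refine h2.mul (Measurable.aemeasurable ?_)
    exact (hk.comp measurable_snd).indicator hset

/-! ### Morrey norms -/

section Morrey
open Metric
variable {n : ℕ}

lemma setLIntegral_ball_mul_le {p q : Fin n → ℝ} (hp : ∀ j, 0 < p j) (hq : ∀ j, 0 < q j)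
    (hpq : ∀ j, 1 / p j + 1 / q j = 1) {g h : Rn n → ℝ≥0∞} (hg : AEMeasurable g)
    (hh : AEMeasurable h) (x : Rn n) (t : ℝ) :
    ∫⁻ y in ball x t, g y * h y ≤
      eMixedNorm p ((ball x t).indicator g) * eMixedNorm q ((ball x t).indicator h) := by
  have hgm := hg.indicator (s := ball x t) measurableSet_ball
  have hhm := hh.indicator (s := ball x t) measurableSet_ball
  refine le_trans (le_of_eq ?_) (eMixedNorm_mul_le (p := fun _ => 1) (fun _ => one_pos) hp hq
    (fun j => by rw [hpq j, one_div_one]) hgm hhm)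
  rw [eMixedNorm_const_exponent one_pos (g := fun y => _ * _) (hgm.mul hhm),
    ← lintegral_indicator measurableSet_ball]
  simp only [ENNReal.rpow_one, one_div_one]
  refine lintegral_congr fun y => ?_
  by_cases hy : y ∈ ball x t <;> simp [hy]

lemma mixedNorm_indicator (p : Fin n → ℝ) (s : Set (Rn n)) (f : Rn n → ℂ) :
    mixedNorm p (s.indicator f) = eMixedNorm p (s.indicator fun y => ‖f y‖ₑ) := by
  simp only [mixedNorm_eq, enorm_indicator_eq_indicator_enorm]

lemma mixedNorm_chiBall (p : Fin n → ℝ) (x : Rn n) (r : ℝ) :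
    mixedNorm p (chiBall x r) = eMixedNorm p ((ball x r).indicator 1) := by
  rw [chiBall, mixedNorm_indicator]
  simp only [enorm_one]
  rfl

lemma mixedNorm_chiBall_ne_zero {p : Fin n → ℝ} (hp : ∀ j, 0 < p j) (x : Rn n) {r : ℝ}
    (hr : 0 < r) : mixedNorm p (chiBall x r) ≠ 0 := by
  rw [mixedNorm_chiBall]
  refine (lt_of_lt_of_le ?_ (le_eMixedNorm_ball hp x hr)).ne'
  rw [ENNReal.ofReal_pos]
  positivity

lemma mixedNorm_chiBall_ne_top {p : Fin n → ℝ} (hp : ∀ j, 0 < p j) (x : Rn n) {r : ℝ}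
    (hr : 0 < r) : mixedNorm p (chiBall x r) ≠ ∞ := by
  rw [mixedNorm_chiBall]
  exact ((eMixedNorm_ball_le hp x hr).trans_lt ENNReal.ofReal_lt_top).ne

lemma mixedNorm_ball_le_morreyNorm {Φ : Rn n → ℝ → ℝ} (hΦ : ∀ x r, 0 < r → 0 < Φ x r)
    {p : Fin n → ℝ} (hp : ∀ j, 0 < p j) (f : Rn n → ℂ) (x : Rn n) {r : ℝ} (hr : 0 < r) :
    mixedNorm p ((ball x r).indicator f) ≤
      morreyNorm Φ p f * (ENNReal.ofReal (Φ x r) * ENNReal.ofReal ((2 * r) ^ ∑ j, 1 / p j)) := by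
  have h1 : ENNReal.ofReal (Φ x r) ≠ 0 := (ENNReal.ofReal_pos.2 (hΦ x r hr)).ne'
  have h2 := mixedNorm_chiBall_ne_zero hp x hr
  have h3 := mixedNorm_chiBall_ne_top hp x hr
  have h4 : (ENNReal.ofReal (Φ x r))⁻¹ * (mixedNorm p (chiBall x r))⁻¹ *
      mixedNorm p ((ball x r).indicator f) ≤ morreyNorm Φ p f :=
    le_iSup_of_le x (le_iSup_of_le r (le_iSup_of_le hr le_rfl))
  rw [← ENNReal.mul_inv (Or.inl h1) (Or.inl ENNReal.ofReal_ne_top), ENNReal.inv_mul_le_iff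
    (mul_ne_zero h1 h2) (ENNReal.mul_ne_top ENNReal.ofReal_ne_top h3), mul_comm] at h4
  refine h4.trans ?_
  gcongr
  rw [mixedNorm_chiBall]
  exact eMixedNorm_ball_le hp x hr

/-- The potential `∫ |f(y)| h(y) max(r, |y - x|)^{-n} dy`. -/
def potential (f : Rn n → ℂ) (h : Rn n → ℝ≥0∞) (x : Rn n) (r : ℝ) : ℝ≥0∞ :=
  ∫⁻ y, ‖f y‖ₑ * h y / ENNReal.ofReal (max r (dist y x)) ^ n

/-- Potentials of a function in a Morrey space with the weight `max(r, |y - x|)^{-n}`. -/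
lemma potential_le (hn : 1 ≤ n) {Φ : Rn n → ℝ → ℝ} (hΦ : ∀ x r, 0 < r → 0 < Φ x r)
    {p q : Fin n → ℝ} (hp : ∀ j, 0 < p j) (hq : ∀ j, 0 < q j) (hpq : ∀ j, 1 / p j + 1 / q j = 1)
    {f : Rn n → ℂ} (hf : MemMorrey Φ p f) {h : Rn n → ℝ≥0∞} (hh : AEMeasurable h)
    (x : Rn n) {r : ℝ} (hr : 0 < r) (C : ℝ≥0) (w : ℝ → ℝ) (hw : ∀ t, r < t → 0 ≤ w t)
    (hhw : ∀ t, r < t → eMixedNorm q ((ball x t).indicator h) ≤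
      C * (ENNReal.ofReal (w t) * ENNReal.ofReal (t ^ ∑ j, 1 / q j))) :
    potential f h x r ≤
      (C * Real.toNNReal (n * 2 ^ ∑ j, 1 / p j) : ℝ≥0) * morreyNorm Φ p f *
        ∫⁻ t in Set.Ioi r, ENNReal.ofReal (w t * Φ x t / t) := by
  rw [potential, lintegral_div_max_pow hn (g := fun y => _ * _) (hf.1.enorm.mul hh) x hr,
    ← lintegral_const_mul' _ _
    (ENNReal.mul_ne_top ENNReal.coe_ne_top hf.2.ne)]
  refine setLIntegral_mono' measurableSet_Ioi fun t ht => ?_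
  have ht : r < t := ht
  have ht0 : 0 < t := hr.trans ht
  have hΦt := hΦ x t ht0
  have hwt := hw t ht
  -- Conjugacy makes the powers of `t` from the kernel and the two norms combine to `t⁻¹`.
  have hs : (∑ j, 1 / q j) = n - ∑ j, 1 / p j := by
    rw [eq_sub_iff_add_eq, ← Finset.sum_add_distrib, Finset.sum_congr rfl fun j _ =>
      (add_comm _ _).trans (hpq j)]
    simp
  calc _ ≤ ENNReal.ofReal (n * t ^ (-(n : ℝ) - 1)) *
        ((morreyNorm Φ p f * (ENNReal.ofReal (Φ x t) * ENNReal.ofReal ((2 * t) ^ ∑ j, 1 / p j))) *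
          (C * (ENNReal.ofReal (w t) * ENNReal.ofReal (t ^ ∑ j, 1 / q j)))) := by
        gcongr
        refine (setLIntegral_ball_mul_le hp hq hpq hf.1.enorm hh x t).trans ?_
        gcongr
        · rw [← mixedNorm_indicator]
          exact mixedNorm_ball_le_morreyNorm hΦ hp f x ht0
        · exact hhw t ht
    _ = C * morreyNorm Φ p f * ENNReal.ofReal (n * t ^ (-(n : ℝ) - 1) *
          (Φ x t * (2 * t) ^ (∑ j, 1 / p j) * (w t * t ^ ∑ j, 1 / q j))) := by
        rw [ENNReal.ofReal_mul (p := n * t ^ (-(n : ℝ) - 1)) (by positivity),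
          ENNReal.ofReal_mul (p := Φ x t * (2 * t) ^ (∑ j, 1 / p j)) (by positivity),
          ENNReal.ofReal_mul (p := Φ x t) hΦt.le, ENNReal.ofReal_mul (p := w t) hwt]
        ring
    _ = C * morreyNorm Φ p f * ENNReal.ofReal (n * 2 ^ (∑ j, 1 / p j) * (w t * Φ x t / t)) := by
        congr 2
        have e : t ^ (-(n : ℝ) - 1) * t ^ (∑ j, 1 / p j) * t ^ (∑ j, 1 / q j) = t⁻¹ := by
          rw [← Real.rpow_add ht0, ← Real.rpow_add ht0, hs, ← Real.rpow_neg_one]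
          congr 1
          ring
        rw [Real.mul_rpow zero_le_two ht0.le, div_eq_mul_inv, ← e]
        ring
    _ = _ := by
        rw [ENNReal.ofReal_mul (by positivity)]
        push_cast
        simp only [ENNReal.ofReal]
        ring

/-- Local norms of a function in a Morrey space. -/
lemma mixedNorm_double_ball_le {Φ : Rn n → ℝ → ℝ} (hΦ : ∀ x r, 0 < r → 0 < Φ x r)
    {p : Fin n → ℝ} (hp : ∀ j, 0 < p j) (hs : 0 < ∑ j, 1 / p j)
    {f : Rn n → ℂ} (hf : MemMorrey Φ p f) (x : Rn n) {r : ℝ} (hr : 0 < r) :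
    mixedNorm p ((ball x (2 * r)).indicator f) ≤
      (Real.toNNReal ((∑ j, 1 / p j) * 2 ^ (∑ j, 1 / p j) * 2 ^ (∑ j, 1 / p j))) *
        morreyNorm Φ p f * ENNReal.ofReal (r ^ ∑ j, 1 / p j) *
          ∫⁻ t in Set.Ioi r, ENNReal.ofReal (Φ x t / t) := by
  set s := ∑ j, 1 / p j with hsdef
  have h2r : 0 < 2 * r := by positivity
  have hc : ENNReal.ofReal ((2 * r) ^ (-s) / s) ≠ 0 := by
    rw [← pos_iff_ne_zero, ENNReal.ofReal_pos]
    positivity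
  -- The prefactor is `∫_{2r}^∞ t^{-s-1} dt`. Under this integral the norm over `B(x,2r)` is
  -- replaced by the larger norm over `B(x,t)`.
  have key : ENNReal.ofReal ((2 * r) ^ (-s) / s) * mixedNorm p ((ball x (2 * r)).indicator f) ≤
      ENNReal.ofReal (2 ^ s) * morreyNorm Φ p f * ∫⁻ t in Set.Ioi r, ENNReal.ofReal (Φ x t / t) := by
    rw [← lintegral_Ioi_rpow hs h2r, ← lintegral_const_mul' _ _
      (ENNReal.mul_ne_top ENNReal.ofReal_ne_top hf.2.ne), ← lintegral_mul_const _ (by fun_prop)]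
    refine le_trans (setLIntegral_mono' measurableSet_Ioi fun t ht => ?_)
      (lintegral_mono_set (Set.Ioi_subset_Ioi (by linarith : r ≤ 2 * r)))
    have ht : 2 * r < t := ht
    have ht0 : 0 < t := h2r.trans ht
    have hΦt := hΦ x t ht0
    calc _ ≤ ENNReal.ofReal (t ^ (-s - 1)) *
          (morreyNorm Φ p f * (ENNReal.ofReal (Φ x t) * ENNReal.ofReal ((2 * t) ^ s))) := by
          gcongr
          refine le_trans ?_ (mixedNorm_ball_le_morreyNorm hΦ hp f x ht0)
          rw [mixedNorm_indicator, mixedNorm_indicator]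
          refine eMixedNorm_mono hp fun y => ?_
          exact Set.indicator_le_indicator_of_subset (ball_subset_ball ht.le) (fun _ => zero_le) y
      _ = morreyNorm Φ p f * ENNReal.ofReal (t ^ (-s - 1) * (Φ x t * (2 * t) ^ s)) := by
          rw [ENNReal.ofReal_mul (p := t ^ (-s - 1)) (by positivity),
            ENNReal.ofReal_mul (p := Φ x t) hΦt.le]
          ring
      _ = morreyNorm Φ p f * ENNReal.ofReal (2 ^ s * (Φ x t / t)) := by
          congr 2
          have e : t ^ (-s - 1) * t ^ s = t⁻¹ := by
            rw [← Real.rpow_add ht0, ← Real.rpow_neg_one]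
            congr 1
            ring
          rw [Real.mul_rpow zero_le_two ht0.le, div_eq_mul_inv, ← e]
          ring
      _ = _ := by
          rw [ENNReal.ofReal_mul (by positivity)]
          ring
  rw [ENNReal.mul_le_iff_le_inv hc ENNReal.ofReal_ne_top] at key
  refine key.trans_eq ?_
  have e1 : (ENNReal.ofReal ((2 * r) ^ (-s) / s))⁻¹ =
      ENNReal.ofReal (s * 2 ^ s) * ENNReal.ofReal (r ^ s) := by
    rw [← ENNReal.ofReal_inv_of_pos (by positivity), ← ENNReal.ofReal_mul (by positivity),
      inv_div, Real.rpow_neg h2r.le, div_inv_eq_mul, Real.mul_rpow zero_le_two hr.le, mul_assoc]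
  rw [e1, ← ENNReal.ofReal, ENNReal.ofReal_mul (p := s * 2 ^ s) (by positivity)]
  ring

end Morrey

/-! ### Operators with the size condition -/

section Operator
open Metric
variable {n m : ℕ}

/-- One far `y k₀` forces the joint distance `D` to be at least `r`. Then `|y_k - x₀| ≤ D + r ≤ 2D`
for every `k`, so the kernel can be shared equally among all variables. -/
lemma inv_pow_norm_le {x x₀ : Rn n} {r : ℝ} (hx : x ∈ ball x₀ r) {y : Fin m → Rn n}
    {k₀ : Fin m} (hk₀ : y k₀ ∉ ball x₀ (2 * r)) (hr : 0 < r) :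
    (ENNReal.ofReal (Real.sqrt (∑ k, ‖x - y k‖ ^ 2)) ^ (m * n))⁻¹ ≤
      2 ^ (m * n) * ∏ k, (ENNReal.ofReal (max r (dist (y k) x₀)) ^ n)⁻¹ := by
  set D := Real.sqrt (∑ k, ‖x - y k‖ ^ 2) with hD
  rw [mem_ball] at hx
  rw [mem_ball, not_lt] at hk₀
  have hle : ∀ k, dist (y k) x ≤ D := by
    intro k
    rw [dist_comm, dist_eq_norm]
    refine Real.le_sqrt_of_sq_le ?_
    exact Finset.single_le_sum (f := fun k => ‖x - y k‖ ^ 2) (fun _ _ => by positivity)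
      (Finset.mem_univ k)
  have hrD : r ≤ D := by
    have := dist_triangle (y k₀) x x₀
    linarith [hle k₀]
  have hmax : ∀ k, max r (dist (y k) x₀) ≤ 2 * D := by
    intro k
    have := dist_triangle (y k) x x₀
    exact max_le (by linarith) (by linarith [hle k])
  have hinv : ∀ k, (ENNReal.ofReal D)⁻¹ ≤ 2 * (ENNReal.ofReal (max r (dist (y k) x₀)))⁻¹ := by
    intro k
    have h1 : ENNReal.ofReal (max r (dist (y k) x₀)) ≤ 2 * ENNReal.ofReal D := by
      refine (ENNReal.ofReal_le_ofReal (hmax k)).trans_eq ?_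
      rw [ENNReal.ofReal_mul zero_le_two, ENNReal.ofReal_ofNat]
    have h2 := ENNReal.inv_le_inv.2 h1
    rw [ENNReal.mul_inv (Or.inl two_ne_zero) (Or.inl ENNReal.ofNat_ne_top)] at h2
    calc (ENNReal.ofReal D)⁻¹ = 2 * (2⁻¹ * (ENNReal.ofReal D)⁻¹) := by
          rw [← mul_assoc, ENNReal.mul_inv_cancel two_ne_zero ENNReal.ofNat_ne_top, one_mul]
      _ ≤ _ := by gcongr
  calc (ENNReal.ofReal D ^ (m * n))⁻¹ = ∏ _k : Fin m, ((ENNReal.ofReal D)⁻¹) ^ n := by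
        rw [Finset.prod_const, Finset.card_univ, Fintype.card_fin, ← pow_mul, mul_comm n m,
          ENNReal.inv_pow]
    _ ≤ ∏ k, (2 ^ n * (ENNReal.ofReal (max r (dist (y k) x₀)) ^ n)⁻¹) := by
        refine Finset.prod_le_prod' fun k _ => ?_
        rw [ENNReal.inv_pow, ← mul_pow]
        exact pow_le_pow_left' (hinv k) n
    _ = _ := by
        rw [Finset.prod_mul_distrib, Finset.prod_const, Finset.card_univ, Fintype.card_fin,
          ← pow_mul, mul_comm n m]

/-- The size integral of functions one of which vanishes on the double ball. -/
lemma sizeIntegral_le {b : Rn n → ℂ} (hb : AEMeasurable b) (i : Fin m)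
    {f g : Fin m → Rn n → ℂ} (hf : ∀ k, AEMeasurable (f k)) (hgf : ∀ k y, ‖g k y‖ₑ ≤ ‖f k y‖ₑ)
    {x x₀ : Rn n} {r : ℝ} (hr : 0 < r) (hx : x ∈ ball x₀ r) {k₀ : Fin m}
    (hk₀ : ∀ y ∈ ball x₀ (2 * r), g k₀ y = 0) (c : ℂ) :
    sizeIntegral b i g x ≤ 2 ^ (m * n) *
      ((‖b x - c‖ₑ * potential (f i) 1 x₀ r + potential (f i) (fun y => ‖b y - c‖ₑ) x₀ r) *
        ∏ k ∈ Finset.univ.erase i, potential (f k) 1 x₀ r) := by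
  set W : Rn n → ℝ≥0∞ := fun y => (ENNReal.ofReal (max r (dist y x₀)) ^ n)⁻¹ with hW
  have hWm : Measurable W := by
    have : Measurable fun y : Rn n => max r (dist y x₀) := by fun_prop
    exact (this.ennreal_ofReal.pow_const n).inv
  -- Placing the factor `|b(x) - b(y_i)|` in slot `i` turns the majorant into a product of functions
  -- of single variables.
  set e : Fin m → Rn n → ℝ≥0∞ := fun k y => if k = i then ‖b x - b y‖ₑ else 1 with he
  have hem : ∀ k, AEMeasurable (e k) := by
    intro k
    by_cases hk : k = i
    · simp only [he, hk, if_true]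
      exact (aemeasurable_const.sub hb).enorm
    · simp only [he, hk, if_false]
      exact aemeasurable_const
  have hu : ∀ k, AEMeasurable (fun y => e k y * ‖f k y‖ₑ * W y) := fun k =>
    ((hem k).mul (hf k).enorm).mul hWm.aemeasurable
  have hpt : ∀ y : Fin m → Rn n,
      ‖b x - b (y i)‖ₑ / ENNReal.ofReal (Real.sqrt (∑ k, ‖x - y k‖ ^ 2)) ^ (m * n) *
        ∏ k, ‖g k (y k)‖ₑ ≤ 2 ^ (m * n) * ∏ k, (e k (y k) * ‖f k (y k)‖ₑ * W (y k)) := by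
    intro y
    by_cases hy : y k₀ ∈ ball x₀ (2 * r)
    · rw [Finset.prod_eq_zero (Finset.mem_univ k₀) (by rw [hk₀ _ hy, enorm_zero]), mul_zero]
      exact zero_le
    · have hprod : ∏ k, e k (y k) = ‖b x - b (y i)‖ₑ := by
        simp [he]
      rw [Finset.prod_mul_distrib, Finset.prod_mul_distrib, hprod, div_eq_mul_inv]
      calc _ ≤ ‖b x - b (y i)‖ₑ * (2 ^ (m * n) * ∏ k, W (y k)) * ∏ k, ‖f k (y k)‖ₑ := by
            gcongr
            · exact inv_pow_norm_le hx hy hr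
            · exact hgf _ _
        _ = _ := by ring
  have hne : ∀ k, k ≠ i → ∫⁻ y, e k y * ‖f k y‖ₑ * W y = potential (f k) 1 x₀ r := by
    intro k hk
    simp [he, hk, potential, hW, div_eq_mul_inv]
  have hfW : AEMeasurable (fun y => ‖f i y‖ₑ * W y) := (hf i).enorm.mul hWm.aemeasurable
  have hi : ∫⁻ y, e i y * ‖f i y‖ₑ * W y ≤
      ‖b x - c‖ₑ * potential (f i) 1 x₀ r + potential (f i) (fun y => ‖b y - c‖ₑ) x₀ r := by
    simp only [potential, Pi.one_apply, mul_one, div_eq_mul_inv]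
    rw [← lintegral_const_mul'' _ hfW, ← lintegral_add_left' (hfW.const_mul _)]
    refine lintegral_mono fun y => ?_
    have h1 : ‖b x - b y‖ₑ ≤ ‖b x - c‖ₑ + ‖b y - c‖ₑ := by
      rw [enorm_sub_rev (b y) c]
      exact enorm_sub_le_add _ _ _
    calc e i y * ‖f i y‖ₑ * W y ≤ (‖b x - c‖ₑ + ‖b y - c‖ₑ) * ‖f i y‖ₑ * W y := by
          simp only [he, if_true]
          gcongr
      _ = _ := by simp only [hW]; ring
  calc sizeIntegral b i g x
      ≤ ∫⁻ y : Fin m → Rn n, 2 ^ (m * n) * ∏ k, (e k (y k) * ‖f k (y k)‖ₑ * W (y k)) :=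
        lintegral_mono hpt
    _ = 2 ^ (m * n) * ∏ k, ∫⁻ y, e k y * ‖f k y‖ₑ * W y := by
        rw [lintegral_const_mul' _ _ (by simp), lintegral_pi_prod hu]
    _ ≤ _ := by
        rw [← Finset.mul_prod_erase _ _ (Finset.mem_univ i)]
        gcongr with k hk
        exact (hne k (Finset.ne_of_mem_erase hk)).le

lemma IsMultiSublinearOn.enorm_le {V : Fin m → Submodule ℂ (Rn n → ℂ)}
    {T : (Fin m → Rn n → ℂ) → Rn n → ℂ} (hT : IsMultiSublinearOn V T) {f f₀ : Fin m → Rn n → ℂ}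
    (hf : ∀ k, f k ∈ V k) (hf₀ : ∀ k, f₀ k ∈ V k) {s : Set (Rn n)} {R : Rn n → ℝ≥0∞}
    (hR : ∀ g : Fin m → Rn n → ℂ, (∀ k, g k = f k ∨ g k = f₀ k ∨ g k = f k - f₀ k) →
      (∃ k, g k = f k - f₀ k) → ∀ᵐ x, x ∈ s → ‖T g x‖ₑ ≤ R x) :
    ∀ᵐ x, x ∈ s → ‖T f x‖ₑ ≤ ‖T f₀ x‖ₑ + m * R x := by
  classical
  -- Telescoping: entries in `S` have been replaced by `f₀`. Each further replacement costs one term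
  -- with an entry `f k - f₀ k`, bounded by `R`.
  have key : ∀ S : Finset (Fin m), ∀ᵐ x, x ∈ s →
      ‖T f x‖ₑ ≤ ‖T (S.piecewise f₀ f) x‖ₑ + S.card * R x := by
    intro S
    induction S using Finset.induction_on with
    | empty => simp
    | insert k S hk ih =>
      set g := S.piecewise f₀ f with hg
      have hgV : ∀ j, g j ∈ V j := by
        intro j
        by_cases hj : j ∈ S <;> simp [hg, hj, hf j, hf₀ j]
      have hgk : g k = f₀ k + (f k - f₀ k) := by simp [hg, hk]
      have h1 := hT.add_le g hgV k (f₀ k) (hf₀ k) (f k - f₀ k) ((V k).sub_mem (hf k) (hf₀ k))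
      rw [← hgk, Function.update_eq_self] at h1
      have h2 := hR (Function.update g k (f k - f₀ k)) (fun j => by
        by_cases hj : j = k
        · subst hj; simp
        · by_cases hjS : j ∈ S <;> simp [hj, hg, hjS]) ⟨k, by simp⟩
      filter_upwards [ih, h1, h2] with x hx1 hx2 hx3 hxs
      rw [Finset.piecewise_insert, Finset.card_insert_of_notMem hk]
      have hx2' : ‖T g x‖ₑ ≤ ‖T (Function.update g k (f₀ k)) x‖ₑ +
          ‖T (Function.update g k (f k - f₀ k)) x‖ₑ := by
        simp only [← ofReal_norm]
        rw [← ENNReal.ofReal_add (norm_nonneg _) (norm_nonneg _)]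
        exact ENNReal.ofReal_le_ofReal hx2
      calc ‖T f x‖ₑ ≤ ‖T g x‖ₑ + S.card * R x := hx1 hxs
        _ ≤ (‖T (Function.update g k (f₀ k)) x‖ₑ + R x) + S.card * R x := by
            gcongr
            exact hx2'.trans (add_le_add le_rfl (hx3 hxs))
        _ = _ := by push_cast; ring
  simpa using key Finset.univ

/-- The local estimate of `T f` on a ball, before taking mixed norms. -/
lemma CommutatorSize.exists_ae_enorm_le {V : Fin m → Submodule ℂ (Rn n → ℂ)} {b : Rn n → ℂ}
    {i : Fin m} {T : (Fin m → Rn n → ℂ) → Rn n → ℂ} (hsize : CommutatorSize V b i T)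
    (hT : IsMultiSublinearOn V T) (hb : AEMeasurable b) (hV : ∀ k, ∀ f ∈ V k, AEMeasurable f) :
    ∃ C : ℝ≥0, ∀ (f : Fin m → Rn n → ℂ) (x₀ : Rn n) (r : ℝ) (c : ℂ), 0 < r →
      (∀ k, f k ∈ V k) → (∀ k, (ball x₀ (2 * r)).indicator (f k) ∈ V k) →
      ∀ᵐ x, x ∈ ball x₀ r → ‖T f x‖ₑ ≤ ‖T (fun k => (ball x₀ (2 * r)).indicator (f k)) x‖ₑ +
        C * ((‖b x - c‖ₑ * potential (f i) 1 x₀ r + potential (f i) (fun y => ‖b y - c‖ₑ) x₀ r) *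
          ∏ k ∈ Finset.univ.erase i, potential (f k) 1 x₀ r) := by
  obtain ⟨C, hC⟩ := hsize
  refine ⟨m * (C * 2 ^ (m * n)), fun f x₀ r c hr hf hf₀ => ?_⟩
  set f₀ : Fin m → Rn n → ℂ := fun k => (ball x₀ (2 * r)).indicator (f k) with hf₀def
  have hmain := hT.enorm_le (f₀ := f₀) hf hf₀ (s := ball x₀ r)
    (R := fun x => C * (2 ^ (m * n) *
      ((‖b x - c‖ₑ * potential (f i) 1 x₀ r + potential (f i) (fun y => ‖b y - c‖ₑ) x₀ r) *
        ∏ k ∈ Finset.univ.erase i, potential (f k) 1 x₀ r))) ?_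
  · filter_upwards [hmain] with x hx hxb
    refine (hx hxb).trans_eq ?_
    push_cast
    ring
  · rintro g hg ⟨k₀, hk₀⟩
    have hgV : ∀ k, g k ∈ V k := by
      intro k
      rcases hg k with h | h | h <;> rw [h]
      exacts [hf k, hf₀ k, (V k).sub_mem (hf k) (hf₀ k)]
    have hgf : ∀ k y, ‖g k y‖ₑ ≤ ‖f k y‖ₑ := by
      intro k y
      rcases hg k with h | h | h <;> rw [h]
      all_goals by_cases hy : y ∈ ball x₀ (2 * r) <;> simp [hf₀def, hy]
    have hzero : ∀ y ∈ ball x₀ (2 * r), g k₀ y = 0 := by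
      intro y hy
      simp [hk₀, hf₀def, Set.indicator_of_mem hy]
    filter_upwards [hC g hgV] with x hx hxb
    refine (hx ?_).trans (mul_le_mul_right (sizeIntegral_le hb i (fun k => hV k _ (hf k)) hgf hr hxb
      hzero c) _)
    -- The open ball `B(x₀,2r)` is a neighbourhood of `x` on which `g k₀` vanishes, so `x` is
    -- outside its closed support.
    intro hmem
    have h1 := Set.mem_iInter.1 hmem k₀
    rw [tsupport, _root_.mem_closure_iff] at h1
    obtain ⟨y, hy1, hy2⟩ := h1 (ball x₀ (2 * r)) isOpen_ball
      (ball_subset_ball (by linarith) hxb)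
    exact hy2 (hzero y hy1)

end Operator

/-! ### The mixed-norm estimate on a single ball -/

section Local
open Metric
variable {n m : ℕ}

/-- The local estimate of `T f` on a ball in the mixed norm. -/
lemma exists_mixedNorm_ball_le (hn : 1 ≤ n) {i : Fin m} {Q : Fin m → Fin n → ℝ}
    (hQ : ∀ k j, 1 < Q k j) {q : Fin n → ℝ} (hq0 : ∀ j, 0 < q j)
    (hq : ∀ j, 1 / q j = ∑ k, 1 / Q k j) {Φ : Fin m → Rn n → ℝ → ℝ}
    (hΦ : ∀ k x r, 0 < r → 0 < Φ k x r) {b : Rn n → ℂ} (hb : MemBMO b)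
    {V : Fin m → Submodule ℂ (Rn n → ℂ)} (hV : ∀ k, ∀ f ∈ V k, AEMeasurable f volume)
    (hVL : ∀ k f, MemMixedLp (Q k) f → f ∈ V k) (hVM : ∀ k f, MemMorrey (Φ k) (Q k) f → f ∈ V k)
    {T : (Fin m → Rn n → ℂ) → Rn n → ℂ} (hTsub : IsMultiSublinearOn V T)
    (hTsize : CommutatorSize V b i T)
    (hTbdd : ∃ C : ℝ≥0, ∀ f : Fin m → Rn n → ℂ, (∀ k, MemMixedLp (Q k) (f k)) →
      MemMixedLp q (T f) ∧ mixedNorm q (T f) ≤ C * ∏ k, mixedNorm (Q k) (f k)) :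
    ∃ C : ℝ≥0, ∀ f : Fin m → Rn n → ℂ, (∀ k, MemMorrey (Φ k) (Q k) (f k)) →
      ∀ (x : Rn n) (r : ℝ), 0 < r → mixedNorm q ((ball x r).indicator (T f)) ≤
        C * ((∏ k, morreyNorm (Φ k) (Q k) (f k)) *
          ((∫⁻ t in Set.Ioi r, ENNReal.ofReal ((1 + Real.log (t / r)) * Φ i x t / t)) *
            ∏ k ∈ Finset.univ.erase i, ∫⁻ t in Set.Ioi r, ENNReal.ofReal (Φ k x t / t))) *
          ENNReal.ofReal (r ^ ∑ j, 1 / q j) := by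
  have hQ0 : ∀ k j, 0 < Q k j := fun k j => one_pos.trans (hQ k j)
  set Q' : Fin m → Fin n → ℝ := fun k j => 1 / (1 - 1 / Q k j) with hQ'
  have hQ'inv : ∀ k j, 1 / Q' k j = 1 - 1 / Q k j := fun k j => by simp [hQ']
  have hQ'0 : ∀ k j, 0 < Q' k j := fun k j =>
    one_div_pos.2 (sub_pos.2 ((div_lt_one (hQ0 k j)).2 (hQ k j)))
  have hQQ' : ∀ k j, 1 / Q k j + 1 / Q' k j = 1 := fun k j => by rw [hQ'inv]; ring
  have hbm : AEMeasurable b := hb.1.aestronglyMeasurable.aemeasurable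
  obtain ⟨A, hA⟩ := hb.exists_oscillationLE
  obtain ⟨Cb, hCb⟩ := exists_eMixedNorm_oscillation_le hb.1 hA hq0
  obtain ⟨CD, hCD⟩ := exists_eMixedNorm_sub_ballMean_le hb.1 hA (hQ'0 i)
  obtain ⟨CT, hCT⟩ := hTbdd
  obtain ⟨CS, hCS⟩ := hTsize.exists_ae_enorm_le hTsub hbm hV
  obtain ⟨K, hK⟩ := exists_eMixedNorm_add_le hq0
  set s : Fin m → ℝ := fun k => ∑ j, 1 / Q k j with hs
  have hs0 : ∀ k, 0 < s k := fun k =>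
    Finset.sum_pos (fun j _ => one_div_pos.2 (hQ0 k j)) ⟨⟨0, hn⟩, Finset.mem_univ _⟩
  have hsq : ∑ j, 1 / q j = ∑ k, s k := by
    rw [Finset.sum_congr rfl fun j _ => hq j, Finset.sum_comm]
  set CA : Fin m → ℝ≥0 := fun k =>
    Real.toNNReal (2 ^ ∑ j, 1 / Q' k j) * Real.toNNReal (n * 2 ^ s k) with hCA
  set CF : Fin m → ℝ≥0 := fun k => Real.toNNReal (s k * 2 ^ s k * 2 ^ s k) with hCF
  set CE : ℝ≥0 := ∏ k ∈ Finset.univ.erase i, CA k with hCE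
  set C2 : ℝ≥0 := Real.toNNReal (2 ^ ∑ j, 1 / q j) with hC2
  set CI : ℝ≥0 := CD * Real.toNNReal (n * 2 ^ s i) with hCI
  -- Three contributions, hence two uses of the quasi-triangle constant `K`: the local term, the
  -- term with `|b(y) - c|` at the evaluation point, and the term with `|b - c|` inside the
  -- potential.
  refine ⟨K * (CT * (∏ k, CF k) + K * (CS * (CA i * CE) * Cb + CS * (CI * CE) * C2)),
    fun f hf x r hr => ?_⟩
  set M : Fin m → ℝ≥0∞ := fun k => morreyNorm (Φ k) (Q k) (f k) with hM
  set I : Fin m → ℝ≥0∞ := fun k => ∫⁻ t in Set.Ioi r, ENNReal.ofReal (Φ k x t / t) with hI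
  set J : ℝ≥0∞ := ∫⁻ t in Set.Ioi r, ENNReal.ofReal ((1 + Real.log (t / r)) * Φ i x t / t) with hJ
  set c := ballMean b x r with hc
  -- Lets the two contributions without a logarithm be absorbed in the same bound `N`.
  have hIJ : I i ≤ J := by
    refine setLIntegral_mono' measurableSet_Ioi fun t (ht : r < t) => ?_
    refine ENNReal.ofReal_le_ofReal ?_
    have ht0 : 0 < t := hr.trans ht
    have := hΦ i x t ht0
    gcongr
    exact le_mul_of_one_le_left this.le (one_le_one_add_log hr ht.le)
  have hpotA : ∀ k, potential (f k) 1 x r ≤ CA k * M k * I k := by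
    intro k
    have h := potential_le hn (hΦ k) (hQ0 k) (hQ'0 k) (hQQ' k) (hf k) (h := 1)
      aemeasurable_const x hr (Real.toNNReal (2 ^ ∑ j, 1 / Q' k j)) (fun _ => 1)
      (fun _ _ => zero_le_one) (fun t ht => by
        have ht0 : 0 < t := hr.trans ht
        refine (eMixedNorm_ball_le (hQ'0 k) x ht0).trans_eq ?_
        rw [Real.mul_rpow zero_le_two ht0.le, ENNReal.ofReal_mul (by positivity),
          ENNReal.ofReal_one, one_mul]
        rfl)
    simpa only [one_mul] using h
  have hpotD : potential (f i) (fun y => ‖b y - c‖ₑ) x r ≤ CI * M i * J :=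
    potential_le hn (hΦ i) (hQ0 i) (hQ'0 i) (hQQ' i) (hf i) (hbm.sub_const c).enorm x hr CD
      (fun t => 1 + Real.log (t / r))
      (fun t ht => zero_le_one.trans (one_le_one_add_log hr (le_of_lt ht)))
      (fun t ht => hCD x r t hr (le_of_lt ht))
  have hlocal : ∀ k, mixedNorm (Q k) ((ball x (2 * r)).indicator (f k)) ≤
      CF k * M k * ENNReal.ofReal (r ^ s k) * I k := fun k =>
    mixedNorm_double_ball_le (hΦ k) (hQ0 k) (hs0 k) (hf k) x hr
  have hmem : ∀ k, MemMixedLp (Q k) ((ball x (2 * r)).indicator (f k)) := by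
    intro k
    refine ⟨(hf k).1.indicator measurableSet_ball, ?_⟩
    refine (mixedNorm_ball_le_morreyNorm (hΦ k) (hQ0 k) (f k) x (by positivity)).trans_lt ?_
    exact ENNReal.mul_lt_top (hf k).2 (ENNReal.mul_lt_top ENNReal.ofReal_lt_top
      ENNReal.ofReal_lt_top)
  obtain ⟨hT0mem, hT0⟩ := hCT _ hmem
  set f₀ : Fin m → Rn n → ℂ := fun k => (ball x (2 * r)).indicator (f k) with hf₀
  set N : ℝ≥0∞ := (∏ k, M k) * (J * ∏ k ∈ Finset.univ.erase i, I k) with hN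
  set ρ : ℝ≥0∞ := ENNReal.ofReal (r ^ ∑ j, 1 / q j) with hρ
  have hprodE : ∏ k ∈ Finset.univ.erase i, potential (f k) 1 x r ≤
      CE * (∏ k ∈ Finset.univ.erase i, M k) * ∏ k ∈ Finset.univ.erase i, I k := by
    rw [hCE, ENNReal.ofNNReal_finsetProd, ← Finset.prod_mul_distrib, ← Finset.prod_mul_distrib]
    exact Finset.prod_le_prod' fun k _ => hpotA k
  have hMi : (∏ k, M k) = M i * ∏ k ∈ Finset.univ.erase i, M k :=
    (Finset.mul_prod_erase _ _ (Finset.mem_univ i)).symm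
  have hglobal : mixedNorm q (T f₀) ≤ CT * (∏ k, CF k : ℝ≥0) * N * ρ := by
    calc mixedNorm q (T f₀) ≤ CT * ∏ k, (CF k * M k * ENNReal.ofReal (r ^ s k) * I k) :=
          hT0.trans (mul_le_mul_right (Finset.prod_le_prod' fun k _ => hlocal k) _)
      _ = CT * (∏ k, CF k : ℝ≥0) * ((∏ k, M k) * (I i * ∏ k ∈ Finset.univ.erase i, I k)) * ρ := by
          rw [Finset.mul_prod_erase _ _ (Finset.mem_univ i), Finset.prod_mul_distrib,
            Finset.prod_mul_distrib, Finset.prod_mul_distrib, hρ, hsq, Real.rpow_sum_of_pos hr,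
            ENNReal.ofReal_prod_of_nonneg (fun k _ => by positivity), ENNReal.ofNNReal_finsetProd]
          ring
      _ ≤ _ := by rw [hN]; gcongr
  have hAE : potential (f i) 1 x r * ∏ k ∈ Finset.univ.erase i, potential (f k) 1 x r ≤
      (CA i * CE : ℝ≥0) * N := by
    calc _ ≤ CA i * M i * J * (CE * (∏ k ∈ Finset.univ.erase i, M k) *
            ∏ k ∈ Finset.univ.erase i, I k) := by
          gcongr
          exact (hpotA i).trans (by gcongr)
      _ = _ := by
          rw [hN, hMi]
          push_cast
          ring
  have hDE : potential (f i) (fun y => ‖b y - c‖ₑ) x r *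
      ∏ k ∈ Finset.univ.erase i, potential (f k) 1 x r ≤ (CI * CE : ℝ≥0) * N := by
    calc _ ≤ CI * M i * J * (CE * (∏ k ∈ Finset.univ.erase i, M k) *
            ∏ k ∈ Finset.univ.erase i, I k) := by gcongr
      _ = _ := by
          rw [hN, hMi]
          push_cast
          ring
  have hosc : AEMeasurable ((ball x r).indicator fun y => ‖b y - c‖ₑ) volume :=
    (hbm.sub_const c).enorm.indicator measurableSet_ball
  have hχ : AEMeasurable ((ball x r).indicator (1 : Rn n → ℝ≥0∞)) volume :=
    (measurable_one.indicator measurableSet_ball).aemeasurable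
  -- In the far part only `|b(y) - c|` depends on the point of the ball; the potentials are centred
  -- at `x` and act as constants.
  have hpt : ∀ᵐ y, (ball x r).indicator (fun y => ‖T f y‖ₑ) y ≤ ‖T f₀ y‖ₑ +
      (CS * ((CA i * CE : ℝ≥0) * N) * (ball x r).indicator (fun y => ‖b y - c‖ₑ) y +
        CS * ((CI * CE : ℝ≥0) * N) * (ball x r).indicator 1 y) := by
    filter_upwards [hCS f x r c hr (fun k => hVM k _ (hf k)) (fun k => hVL k _ (hmem k))] with y hy
    by_cases hyb : y ∈ ball x r
    · simp only [Set.indicator_of_mem hyb, Pi.one_apply, mul_one]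
      refine (hy hyb).trans ?_
      gcongr
      calc _ = CS * (potential (f i) 1 x r * ∏ k ∈ Finset.univ.erase i, potential (f k) 1 x r) *
              ‖b y - c‖ₑ + CS * (potential (f i) (fun y => ‖b y - c‖ₑ) x r *
                ∏ k ∈ Finset.univ.erase i, potential (f k) 1 x r) := by ring
        _ ≤ _ := by gcongr
    · simp [hyb]
  calc mixedNorm q ((ball x r).indicator (T f))
      = eMixedNorm q ((ball x r).indicator fun y => ‖T f y‖ₑ) := mixedNorm_indicator _ _ _
    _ ≤ _ := eMixedNorm_mono_ae hq0 hpt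
    _ ≤ K * (eMixedNorm q (fun y => ‖T f₀ y‖ₑ) + _) :=
        hK _ _ hT0mem.1.enorm ((hosc.const_mul _).add (hχ.const_mul _))
    _ ≤ K * (CT * (∏ k, CF k : ℝ≥0) * N * ρ +
          K * (CS * ((CA i * CE : ℝ≥0) * N) * (Cb * ρ) +
            CS * ((CI * CE : ℝ≥0) * N) * (C2 * ρ))) := by
        gcongr
        · exact hglobal
        · refine (hK _ _ (hosc.const_mul _) (hχ.const_mul _)).trans ?_
          rw [eMixedNorm_const_mul hq0 _ hosc, eMixedNorm_const_mul hq0 _ hχ]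
          gcongr
          · exact hCb x r hr
          · refine (eMixedNorm_ball_le hq0 x hr).trans_eq ?_
            rw [Real.mul_rpow zero_le_two hr.le, ENNReal.ofReal_mul (by positivity)]
            rfl
    _ = _ := by
        push_cast
        ring

end Local

end MixedMorrey

end

/-! ### From single balls to the Morrey norm -/

theorem theorem4p2 (n m : ℕ) (hn : 1 ≤ n) (hm : 2 ≤ m) (i : Fin m)
    (Q : Fin m → Fin n → ℝ) (hQ : ∀ k j, 1 < Q k j)
    (q : Fin n → ℝ) (hq : ∀ j, 1 / q j = ∑ k, 1 / Q k j)
    (φ : MixedMorrey.Rn n → ℝ → ℝ) (hφ : MixedMorrey.IsWeightFun φ)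
    (Φ : Fin m → MixedMorrey.Rn n → ℝ → ℝ) (hΦ : ∀ k, MixedMorrey.IsWeightFun (Φ k))
    -- the integrals over `t` below are integrals of measurable functions, for every `x`
    (hΦt : ∀ k x, AEMeasurable (Φ k x) ((volume : Measure ℝ).restrict (Set.Ioi 0)))
    (hcond : ∃ C : ℝ≥0, ∀ x : MixedMorrey.Rn n, ∀ r : ℝ, 0 < r →
      (∫⁻ t in Set.Ioi r, ENNReal.ofReal ((1 + Real.log (t / r)) * Φ i x t / t)) *
        ∏ k ∈ Finset.univ.erase i, ∫⁻ t in Set.Ioi r, ENNReal.ofReal (Φ k x t / t)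
        ≤ C * ENNReal.ofReal (φ x r))
    (b : MixedMorrey.Rn n → ℂ) (hb : MixedMorrey.MemBMO b)
    -- the operator `T` acts on `V₁ × ⋯ × Vₘ`, where `V k` is a space of measurable functions
    -- containing the mixed Lebesgue space and the generalized mixed Morrey space
    (V : Fin m → Submodule ℂ (MixedMorrey.Rn n → ℂ))
    (hV : ∀ k, ∀ f ∈ V k, AEMeasurable f volume)
    (hVL : ∀ k f, MixedMorrey.MemMixedLp (Q k) f → f ∈ V k)
    (hVM : ∀ k f, MixedMorrey.MemMorrey (Φ k) (Q k) f → f ∈ V k)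
    (T : (Fin m → MixedMorrey.Rn n → ℂ) → MixedMorrey.Rn n → ℂ)
    (hTmeas : ∀ f, (∀ k, f k ∈ V k) → AEMeasurable (T f) volume)
    (hTsub : MixedMorrey.IsMultiSublinearOn V T)
    (hTsize : MixedMorrey.CommutatorSize V b i T)
    (hTbdd : ∃ C : ℝ≥0, ∀ f : Fin m → MixedMorrey.Rn n → ℂ,
      (∀ k, MixedMorrey.MemMixedLp (Q k) (f k)) →
        MixedMorrey.MemMixedLp q (T f) ∧
          MixedMorrey.mixedNorm q (T f) ≤ C * ∏ k, MixedMorrey.mixedNorm (Q k) (f k)) :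
    ∃ C : ℝ≥0, ∀ f : Fin m → MixedMorrey.Rn n → ℂ,
      (∀ k, MixedMorrey.MemMorrey (Φ k) (Q k) (f k)) →
        MixedMorrey.MemMorrey φ q (T f) ∧
          MixedMorrey.morreyNorm φ q (T f) ≤
            C * ∏ k, MixedMorrey.morreyNorm (Φ k) (Q k) (f k) := by
  have hQ0 : ∀ k j, 0 < Q k j := fun k j => one_pos.trans (hQ k j)
  have hq0 : ∀ j, 0 < q j := fun j => one_div_pos.1 (by
    rw [hq j]
    exact Finset.sum_pos (fun k _ => one_div_pos.2 (hQ0 k j)) ⟨i, Finset.mem_univ i⟩)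
  obtain ⟨C, hC⟩ := MixedMorrey.exists_mixedNorm_ball_le hn hQ hq0 hq (fun k => (hΦ k).1) hb hV hVL
    hVM hTsub hTsize hTbdd
  obtain ⟨Cφ, hCφ⟩ := hcond
  set s : ℝ := ∑ j, 1 / q j with hs
  -- The inverse constant of `le_eMixedNorm_ball`: it converts `r ^ s` into the norm of the
  -- characteristic function of the ball.
  set C3 : ℝ≥0 := Real.toNNReal (((2 : ℝ) / (n + 1)) ^ s)⁻¹ with hC3
  have hbound : ∀ f : Fin m → MixedMorrey.Rn n → ℂ,
      (∀ k, MixedMorrey.MemMorrey (Φ k) (Q k) (f k)) →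
      MixedMorrey.morreyNorm φ q (T f) ≤
        (C * Cφ * C3 : ℝ≥0) * ∏ k, MixedMorrey.morreyNorm (Φ k) (Q k) (f k) := by
    intro f hf
    refine iSup_le fun x => iSup_le fun r => iSup_le fun hr => ?_
    have h1 : ENNReal.ofReal (φ x r) ≠ 0 := (ENNReal.ofReal_pos.2 (hφ.1 x r hr)).ne'
    have h2 := MixedMorrey.mixedNorm_chiBall_ne_zero hq0 x hr
    have h3 := MixedMorrey.mixedNorm_chiBall_ne_top hq0 x hr
    have h4 : ENNReal.ofReal (r ^ s) ≤ C3 * MixedMorrey.mixedNorm q (MixedMorrey.chiBall x r) := by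
      have h5 := MixedMorrey.le_eMixedNorm_ball hq0 x hr
      rw [← MixedMorrey.mixedNorm_chiBall] at h5
      refine le_trans (le_of_eq ?_) (mul_le_mul_right h5 _)
      have hpos : 0 < ((2 : ℝ) / (n + 1)) ^ s := by positivity
      rw [hC3, ← ENNReal.ofReal, ← ENNReal.ofReal_mul (by positivity), ← hs,
        show 2 * (r / ((n : ℝ) + 1)) = 2 / (n + 1) * r by ring,
        Real.mul_rpow (by positivity) hr.le, inv_mul_cancel_left₀ hpos.ne']
    rw [← ENNReal.mul_inv (Or.inl h1) (Or.inl ENNReal.ofReal_ne_top), ENNReal.inv_mul_le_iff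
      (mul_ne_zero h1 h2) (ENNReal.mul_ne_top ENNReal.ofReal_ne_top h3)]
    calc _ ≤ _ := hC f hf x r hr
      _ ≤ C * ((∏ k, MixedMorrey.morreyNorm (Φ k) (Q k) (f k)) *
            (Cφ * ENNReal.ofReal (φ x r))) *
              (C3 * MixedMorrey.mixedNorm q (MixedMorrey.chiBall x r)) := by
          refine mul_le_mul' (mul_le_mul_right (mul_le_mul_right (hCφ x r hr) _) _) h4
      _ = _ := by
          push_cast
          ring
  refine ⟨C * Cφ * C3, fun f hf => ⟨⟨hTmeas f fun k => hVM k _ (hf k), ?_⟩, hbound f hf⟩⟩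
  refine (hbound f hf).trans_lt (ENNReal.mul_lt_top ENNReal.coe_lt_top ?_)
  exact ENNReal.prod_lt_top fun k _ => (hf k).2
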